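/- **Theorem (planar Max-Weight Rectangle hardness).** Let $\varepsilon>0$ be a constant. If there is an algorithm that solves Max-Weight Rectangle on $N$ weighted points in the plane in time $O(N^{2-\varepsilon})$, then there is an algorithm that solves Max-Weight $\lceil 4/\varepsilon\rceil$-Clique on weighted graphs with $n$ vertices in time $O(n^{\lceil 4/\varepsilon\rceil-\varepsilon})$. *Problems.* Max-Weight Rectangle in the plane: given $N$ points of $\mathbb{R}^2$ (not necessarily distinct) with arbitrary real weights, output a closed axis-parallel box $[a,b]\times[c,d]$ with $a\le b$, $c\le d$ for which the total weight of the points it contains is maximum. Max-Weight $k$-Clique, for a fixed integer $k$: given a complete graph on $n\ge k$ vertices with arbitrary real edge weights (as a weighted adjacency matrix), output the maximum total edge weight of a $k$-clique. *Model.* An algorithm is a deterministic real RAM program. It has index registers holding natural numbers, real registers, and finitely many unbounded zero-initialised arrays of either kind, addressed through index registers. Each of the following costs one step: loading or storing an array cell, setting an integer constant, addition or truncated subtraction of indices, exact $+,-,\cdot,/$ on reals, converting an index to a real, comparing two index registers or two real registers. There is no conversion from reals to indices. Running time $O(f(n))$ means that for some $T:\mathbb{N}\to\mathbb{N}$ with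 $T(n)=O(f(n))$ as $n\to\infty$, the program halts with a correct output within $T(n)$ steps on every input of size $n$, where the size is the number of points or of vertices. -/

import Mathlib

open Filter Asymptotics

/-! ## The real RAM

A real RAM has index registers (natural numbers), real registers, and finitely many unbounded
arrays of either kind with indirect addressing. A program is a finite text that names only
finitely many registers and arrays. It is written in structured form (sequence, branch, loop).
Every elementary instruction and every evaluation of a test costs one step. Exact real arithmetic
`+, -, *, /` and comparison are available; there is no rounding of a real to an integer, and the
only real constants in a program are integers. Index arithmetic is addition and
(truncated) subtraction. -/

namespace RealRAM

/-- Memory contents: registers and array cells are addressed by natural numbers. -/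
structure State where
  /-- index registers -/
  ireg : ℕ → ℕ
  /-- real registers -/
  rreg : ℕ → ℝ
  /-- `iarr A i` is cell `i` of the index array `A` -/
  iarr : ℕ → ℕ → ℕ
  /-- `rarr A i` is cell `i` of the real array `A` -/
  rarr : ℕ → ℕ → ℝ

/-- Elementary instructions. The arguments are the literal names of registers (`r`, `a`, `b`, `i`)
and arrays (`A`), except that `c` is a literal constant. -/
inductive Instr where
  | iconst (r c : ℕ)
  | iadd (r a b : ℕ)
  | isub (r a b : ℕ)
  | iload (r A i : ℕ)
  | istore (A i a : ℕ)
  | rconst (r : ℕ) (c : ℤ)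
  | rcast (r a : ℕ)
  | radd (r a b : ℕ)
  | rsub (r a b : ℕ)
  | rmul (r a b : ℕ)
  | rdiv (r a b : ℕ)
  | rload (r A i : ℕ)
  | rstore (A i a : ℕ)

/-- Overwrite the index register `r`. -/
def State.setI (s : State) (r v : ℕ) : State :=
  { s with ireg := Function.update s.ireg r v }

/-- Overwrite the real register `r`. -/
def State.setR (s : State) (r : ℕ) (v : ℝ) : State :=
  { s with rreg := Function.update s.rreg r v }

/-- Overwrite cell `i` of the index array `A`. -/
def State.setIArr (s : State) (A i v : ℕ) : State :=
  { s with iarr := Function.update s.iarr A (Function.update (s.iarr A) i v) }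

/-- Overwrite cell `i` of the real array `A`. -/
def State.setRArr (s : State) (A i : ℕ) (v : ℝ) : State :=
  { s with rarr := Function.update s.rarr A (Function.update (s.rarr A) i v) }

/-- The effect of an elementary instruction. Array cells are addressed through the current content
of an index register. -/
noncomputable def Instr.apply : Instr → State → State
  | iconst r c, s => s.setI r c
  | iadd r a b, s => s.setI r (s.ireg a + s.ireg b)
  | isub r a b, s => s.setI r (s.ireg a - s.ireg b)
  | iload r A i, s => s.setI r (s.iarr A (s.ireg i))
  | istore A i a, s => s.setIArr A (s.ireg i) (s.ireg a)
  | rconst r c, s => s.setR r (c : ℝ)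
  | rcast r a, s => s.setR r (s.ireg a : ℝ)
  | radd r a b, s => s.setR r (s.rreg a + s.rreg b)
  | rsub r a b, s => s.setR r (s.rreg a - s.rreg b)
  | rmul r a b, s => s.setR r (s.rreg a * s.rreg b)
  | rdiv r a b, s => s.setR r (s.rreg a / s.rreg b)
  | rload r A i, s => s.setR r (s.rarr A (s.ireg i))
  | rstore A i a, s => s.setRArr A (s.ireg i) (s.rreg a)

/-- Tests: strict comparison of two index registers or of two real registers. -/
inductive Test where
  | ilt (a b : ℕ)
  | rlt (a b : ℕ)

/-- The test succeeds in the given state. -/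
def Test.Holds : Test → State → Prop
  | ilt a b, s => s.ireg a < s.ireg b
  | rlt a b, s => s.rreg a < s.rreg b

/-- Programs. -/
inductive Prog where
  | skip
  | instr (e : Instr)
  | seq (p q : Prog)
  | branch (c : Test) (p q : Prog)
  | loop (c : Test) (p : Prog)

/-- `Exec p s t s'`: started in state `s`, the program `p` halts in state `s'` after exactly `t`
steps. (A program that does not halt from `s` has no such `t` and `s'`.) -/
inductive Exec : Prog → State → ℕ → State → Prop
  | skip (s : State) : Exec .skip s 1 s
  | instr (e : Instr) (s : State) : Exec (.instr e) s 1 (e.apply s)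
  | seq {p q : Prog} {s s₁ s₂ : State} {t₁ t₂ : ℕ} :
      Exec p s t₁ s₁ → Exec q s₁ t₂ s₂ → Exec (.seq p q) s (t₁ + t₂) s₂
  | branchTrue {c : Test} {p q : Prog} {s s₁ : State} {t : ℕ} :
      c.Holds s → Exec p s t s₁ → Exec (.branch c p q) s (1 + t) s₁
  | branchFalse {c : Test} {p q : Prog} {s s₁ : State} {t : ℕ} :
      ¬ c.Holds s → Exec q s t s₁ → Exec (.branch c p q) s (1 + t) s₁
  | loopTrue {c : Test} {p : Prog} {s s₁ s₂ : State} {t₁ t₂ : ℕ} :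
      c.Holds s → Exec p s t₁ s₁ → Exec (.loop c p) s₁ t₂ s₂ →
      Exec (.loop c p) s (1 + t₁ + t₂) s₂
  | loopFalse {c : Test} {p : Prog} {s : State} :
      ¬ c.Holds s → Exec (.loop c p) s 1 s

end RealRAM

/-! ## Max-Weight Rectangle in the plane -/

section Rectangle

variable {N : ℕ}

open Classical in
/-- Total weight of the points in the closed axis-parallel box with lower left corner `lo` and
upper right corner `hi` (`ℝ × ℝ` has the coordinatewise order). -/
noncomputable def boxWeight (pts : Fin N → ℝ × ℝ) (wt : Fin N → ℝ) (lo hi : ℝ × ℝ) : ℝ :=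
  ∑ i with pts i ∈ Set.Icc lo hi, wt i

/-- The box with corners `lo ≤ hi` has the largest total weight among all axis-parallel boxes. -/
def IsMaxWeightBox (pts : Fin N → ℝ × ℝ) (wt : Fin N → ℝ) (lo hi : ℝ × ℝ) : Prop :=
  lo ≤ hi ∧ ∀ lo' hi' : ℝ × ℝ, lo' ≤ hi' → boxWeight pts wt lo' hi' ≤ boxWeight pts wt lo hi

/-- Input of Max-Weight Rectangle: `N` in index register `0`, the two coordinates and the weight
of the `i`-th point in cell `i` of the real arrays `0`, `1`, `2`, and zero elsewhere. -/
noncomputable def rectangleInput (pts : Fin N → ℝ × ℝ) (wt : Fin N → ℝ) : RealRAM.State where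
  ireg r := if r = 0 then N else 0
  rreg _ := 0
  iarr _ _ := 0
  rarr A i :=
    if h : i < N then
      if A = 0 then (pts ⟨i, h⟩).1
      else if A = 1 then (pts ⟨i, h⟩).2
      else if A = 2 then wt ⟨i, h⟩
      else 0
    else 0

end Rectangle

/-- `P` solves Max-Weight Rectangle in the plane with running time `T`: on all `N` points (not
necessarily distinct) with real coordinates and weights, it halts within `T N` steps with the
corners `(R₀, R₁) ≤ (R₂, R₃)` of a box of maximum weight in the real registers `0` to `3`. -/
def SolvesMaxWeightRectangle (P : RealRAM.Prog) (T : ℕ → ℕ) : Prop :=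
  ∀ (N : ℕ) (pts : Fin N → ℝ × ℝ) (wt : Fin N → ℝ), ∃ (t : ℕ) (s : RealRAM.State),
    RealRAM.Exec P (rectangleInput pts wt) t s ∧ t ≤ T N ∧
    IsMaxWeightBox pts wt (s.rreg 0, s.rreg 1) (s.rreg 2, s.rreg 3)

/-! ## Max-Weight `k`-Clique -/

section Clique

variable {n : ℕ}

/-- Total weight of the edges inside the vertex set `S`, each edge counted once. -/
def cliqueWeight (w : Fin n → Fin n → ℝ) (S : Finset (Fin n)) : ℝ :=
  ∑ i ∈ S, ∑ j ∈ S with i < j, w i j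

/-- Input of Max-Weight `k`-Clique: `n` in index register `0`, the weighted adjacency matrix
row by row (`w i j` in cell `i * n + j`) in real array `0`, and zero elsewhere. -/
noncomputable def cliqueInput (w : Fin n → Fin n → ℝ) : RealRAM.State where
  ireg r := if r = 0 then n else 0
  rreg _ := 0
  iarr _ _ := 0
  rarr A m :=
    if h : A = 0 ∧ m < n * n then
      w ⟨m / n, Nat.div_lt_of_lt_mul h.2⟩
        ⟨m % n, Nat.mod_lt m (Nat.pos_of_mul_pos_left (Nat.zero_lt_of_lt h.2))⟩
    else 0

end Clique

/-- `Q` solves Max-Weight `k`-Clique with running time `T`: on every complete graph with `n ≥ k`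
vertices and real edge weights `w i j = w j i` (the diagonal is irrelevant), it halts within `T n`
steps with the maximum total edge weight of a `k`-clique in the real register `0`. -/
def SolvesMaxWeightClique (k : ℕ) (Q : RealRAM.Prog) (T : ℕ → ℕ) : Prop :=
  ∀ (n : ℕ) (w : Fin n → Fin n → ℝ), k ≤ n → (∀ i j, w i j = w j i) →
    ∃ (t : ℕ) (s : RealRAM.State),
      RealRAM.Exec Q (cliqueInput w) t s ∧ t ≤ T n ∧
      IsGreatest (cliqueWeight w '' {S | (⊤ : SimpleGraph (Fin n)).IsNClique k S}) (s.rreg 0)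


/-!
A box around the origin is given by how far it reaches along the four half-axes. Reading each
distance as a fraction in base `n`, the box spells out digits, and we let these digits name the
vertices of a `k`-clique: vertex `a` is spelled once on a horizontal half-axis and once on a
vertical one. Four points of weights `g, -g, -g, g` at the corners of a rectangle contribute `g`
exactly to the boxes that end between the corners, so a grid of such rectangles can add the weight
of an edge to all boxes in which the two endpoints have given values. Similar gadgets reward boxes
whose two spellings agree, and a heavy point makes sure that an optimal box contains the origin.

A gadget that looks at digit `i` of a horizontal and digit `j` of a vertical half-axis, counted
from `0`, has to repeat its rectangles for all values of the `i` and `j` digits before them: that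
makes `n ^ (i + j + 2)` rectangles for an edge. Using the two directions of an axis for vertices of
different parity, and spelling in opposite orders on the two axes, bounds this by
`n ^ (k / 2 + 1)`. With `k ε ≥ 4`, time `N ^ (2 - ε)` on `N` such points is
at most `n ^ (k - ε)`. The instance can be written down in this time because `ε ≤ 1`: a rectangle
algorithm has to read all of its input, for a point it has not read could be the only one of
positive weight.
-/

namespace RealRAM

section Memory

variable (s : State) (A B i r q v : ℕ) (x : ℝ)

@[simp]
theorem State.setI_ireg : (s.setI r v).ireg q = if q = r then v else s.ireg q := by
  simp [State.setI, Function.update_apply]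

@[simp] theorem State.setI_rreg : (s.setI r v).rreg = s.rreg := rfl

@[simp] theorem State.setI_iarr : (s.setI r v).iarr = s.iarr := rfl

@[simp] theorem State.setI_rarr : (s.setI r v).rarr = s.rarr := rfl

@[simp]
theorem State.setR_rreg : (s.setR r x).rreg q = if q = r then x else s.rreg q := by
  simp [State.setR, Function.update_apply]

@[simp] theorem State.setR_ireg : (s.setR r x).ireg = s.ireg := rfl

@[simp] theorem State.setR_iarr : (s.setR r x).iarr = s.iarr := rfl

@[simp] theorem State.setR_rarr : (s.setR r x).rarr = s.rarr := rfl

@[simp]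
theorem State.setRArr_rarr : (s.setRArr A i x).rarr B =
    if B = A then Function.update (s.rarr A) i x else s.rarr B := by
  simp [State.setRArr, Function.update_apply]

@[simp] theorem State.setRArr_ireg : (s.setRArr A i x).ireg = s.ireg := rfl

@[simp] theorem State.setRArr_rreg : (s.setRArr A i x).rreg = s.rreg := rfl

variable {i} in
theorem State.setRArr_comm {j : ℕ} (y : ℝ) (h : i ≠ j) :
    (s.setRArr A i x).setRArr B j y = (s.setRArr B j y).setRArr A i x := by
  simp only [State.setRArr, State.mk.injEq, true_and]
  rcases eq_or_ne A B with rfl | hAB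
  · simp [Function.update_comm h]
  · rw [Function.update_comm hAB]
    simp [Function.update_of_ne hAB, Function.update_of_ne hAB.symm]

end Memory

/-! ### Unread memory -/

theorem Instr.exists_apply_setRArr (e : Instr) (s : State) (A : ℕ) : ∃ c : ℕ, ∀ i ≠ c, ∀ x : ℝ,
    e.apply (s.setRArr A i x) = (e.apply s).setRArr A i x := by
  cases e with
  | rload r B j =>
    refine ⟨s.ireg j, fun i hi x => ?_⟩
    have hread : (s.setRArr A i x).rarr B (s.ireg j) = s.rarr B (s.ireg j) := by
      simp only [State.setRArr_rarr]
      split_ifs with hBA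
      · rw [Function.update_of_ne hi.symm, hBA]
      · rfl
    simp only [Instr.apply, State.setRArr_ireg, hread]
    rfl
  | rstore B j a => exact ⟨s.ireg j, fun i hi x => s.setRArr_comm A B x (s.rreg a) hi⟩
  | _ => exact ⟨0, fun i _ x => rfl⟩

theorem Test.holds_setRArr (c : Test) (s : State) (A i : ℕ) (x : ℝ) :
    c.Holds (s.setRArr A i x) ↔ c.Holds s := by
  cases c <;> rfl

/-- Each step touches at most one cell of a given array. -/
theorem Exec.exists_untouched {p : Prog} {s s' : State} {t : ℕ} (h : Exec p s t s') (A : ℕ) :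
    ∃ F : Finset ℕ, F.card ≤ t ∧ ∀ i ∉ F, ∀ x : ℝ,
      Exec p (s.setRArr A i x) t (s'.setRArr A i x) := by
  induction h with
  | skip s => exact ⟨∅, by simp, fun i _ x => .skip _⟩
  | instr e s =>
    obtain ⟨c, hc⟩ := e.exists_apply_setRArr s A
    refine ⟨{c}, by simp, fun i hi x => ?_⟩
    rw [← hc i (by simpa using hi) x]
    exact .instr _ _
  | seq _ _ ih₁ ih₂ =>
    obtain ⟨F, hF, hp⟩ := ih₁
    obtain ⟨G, hG, hq⟩ := ih₂
    refine ⟨F ∪ G, (Finset.card_union_le _ _).trans (by lia), fun i hi x => ?_⟩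
    rw [Finset.mem_union, not_or] at hi
    exact .seq (hp i hi.1 x) (hq i hi.2 x)
  | branchTrue hc _ ih =>
    obtain ⟨F, hF, hp⟩ := ih
    exact ⟨F, by lia, fun i hi x =>
      .branchTrue ((Test.holds_setRArr _ _ _ _ _).2 hc) (hp i hi x)⟩
  | branchFalse hc _ ih =>
    obtain ⟨F, hF, hp⟩ := ih
    exact ⟨F, by lia, fun i hi x =>
      .branchFalse (mt (Test.holds_setRArr _ _ _ _ _).1 hc) (hp i hi x)⟩
  | loopTrue hc _ _ ih₁ ih₂ =>
    obtain ⟨F, hF, hp⟩ := ih₁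
    obtain ⟨G, hG, hq⟩ := ih₂
    refine ⟨F ∪ G, (Finset.card_union_le _ _).trans (by lia), fun i hi x => ?_⟩
    rw [Finset.mem_union, not_or] at hi
    exact .loopTrue ((Test.holds_setRArr _ _ _ _ _).2 hc) (hp i hi.1 x) (hq i hi.2 x)
  | loopFalse hc =>
    exact ⟨∅, by simp, fun i _ x => .loopFalse (mt (Test.holds_setRArr _ _ _ _ _).1 hc)⟩

theorem Exec.final_unique {p : Prog} {s s₁ s₂ : State} {t₁ t₂ : ℕ} (h₁ : Exec p s t₁ s₁)
    (h₂ : Exec p s t₂ s₂) : s₁ = s₂ := by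
  induction h₁ generalizing s₂ t₂ with
  | skip s => cases h₂; rfl
  | instr e s => cases h₂; rfl
  | seq _ _ ih₁ ih₂ =>
    cases h₂ with
    | seq hp hq => obtain rfl := ih₁ hp; exact ih₂ hq
  | branchTrue hc _ ih =>
    cases h₂ with
    | branchTrue _ hp => exact ih hp
    | branchFalse hn _ => exact absurd hc hn
  | branchFalse hn _ ih =>
    cases h₂ with
    | branchTrue hc _ => exact absurd hc hn
    | branchFalse _ hq => exact ih hq
  | loopTrue hc _ _ ih₁ ih₂ =>
    cases h₂ with
    | loopTrue _ hp hq => obtain rfl := ih₁ hp; exact ih₂ hq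
    | loopFalse hn => exact absurd hc hn
  | loopFalse hn =>
    cases h₂ with
    | loopTrue hc _ _ => exact absurd hc hn
    | loopFalse _ => rfl

end RealRAM

section ConstantPoints

variable {N : ℕ} {c lo hi : ℝ × ℝ} {wt : Fin N → ℝ}

open Classical in
theorem boxWeight_const :
    boxWeight (fun _ => c) wt lo hi = if c ∈ Set.Icc lo hi then ∑ i, wt i else 0 := by
  rw [boxWeight, Finset.sum_filter]
  split_ifs <;> simp

theorem IsMaxWeightBox.notMem_of_sum_neg (h : IsMaxWeightBox (fun _ => c) wt lo hi)
    (hwt : ∑ i, wt i < 0) : c ∉ Set.Icc lo hi := by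
  intro hc
  have hle := h.2 (c + 1) (c + 1) le_rfl
  have hout : c ∉ Set.Icc (c + 1) (c + 1) := fun hmem => (lt_add_one c.1).not_ge hmem.1.1
  rw [boxWeight_const, boxWeight_const, if_pos hc, if_neg hout] at hle
  exact hle.not_gt hwt

theorem IsMaxWeightBox.mem_of_sum_pos (h : IsMaxWeightBox (fun _ => c) wt lo hi)
    (hwt : 0 < ∑ i, wt i) : c ∈ Set.Icc lo hi := by
  by_contra hc
  have hle := h.2 c c le_rfl
  rw [boxWeight_const, boxWeight_const, if_neg hc, if_pos ⟨le_rfl, le_rfl⟩] at hle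
  exact hle.not_gt hwt

end ConstantPoints

theorem rectangleInput_setRArr_weight {N : ℕ} (pts : Fin N → ℝ × ℝ) (wt : Fin N → ℝ) (i : Fin N)
    (x : ℝ) : (rectangleInput pts wt).setRArr 2 i x =
      rectangleInput pts (Function.update wt i x) := by
  simp only [RealRAM.State.setRArr, rectangleInput, RealRAM.State.mk.injEq, true_and]
  ext A j
  rcases ne_or_eq A 2 with hA | rfl
  · simp [hA]
  rcases ne_or_eq j i with hj | rfl
  · simp [hj, Fin.ext_iff]
  · simp

open RealRAM in
/-- If all points lie at the origin and have weight `-1`, the box must avoid the origin; but a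
point whose weight was never read might as well outweigh all the others. -/
theorem SolvesMaxWeightRectangle.le_time {P : Prog} {T : ℕ → ℕ}
    (h : SolvesMaxWeightRectangle P T) (N : ℕ) : N ≤ T N := by
  by_contra! hlt
  obtain ⟨t, s, hex, ht, hbox⟩ := h N (fun _ => 0) (fun _ => -1)
  obtain ⟨F, hF, hfresh⟩ := hex.exists_untouched 2
  obtain ⟨j, hj, hjF⟩ := Finset.exists_mem_notMem_of_card_lt_card (s := F) (t := Finset.range N)
    (by rw [Finset.card_range]; lia)
  let i : Fin N := ⟨j, Finset.mem_range.1 hj⟩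
  have hex' := hfresh j hjF N
  rw [show j = i from rfl, rectangleInput_setRArr_weight] at hex'
  obtain ⟨t', s', hex'', -, hbox'⟩ := h N (fun _ => 0) (Function.update (fun _ => -1) i (N : ℝ))
  obtain rfl := hex'.final_unique hex''
  have hN : (1 : ℝ) ≤ N := by exact_mod_cast i.pos
  refine hbox.notMem_of_sum_neg ?_ (hbox'.mem_of_sum_pos ?_)
  · simp only [Finset.sum_const, Finset.card_fin, nsmul_eq_mul]
    linarith
  · simp [Finset.sum_update_of_mem, Finset.card_sdiff, Nat.cast_sub i.pos]

namespace RealRAM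

/-! ### Relocating a program -/

/-- Add `d` to the names of all registers and arrays, so that a program used as a subroutine
finds its own memory. -/
def Instr.shift (d : ℕ) : Instr → Instr
  | iconst r c => iconst (r + d) c
  | iadd r a b => iadd (r + d) (a + d) (b + d)
  | isub r a b => isub (r + d) (a + d) (b + d)
  | iload r A i => iload (r + d) (A + d) (i + d)
  | istore A i a => istore (A + d) (i + d) (a + d)
  | rconst r c => rconst (r + d) c
  | rcast r a => rcast (r + d) (a + d)
  | radd r a b => radd (r + d) (a + d) (b + d)
  | rsub r a b => rsub (r + d) (a + d) (b + d)
  | rmul r a b => rmul (r + d) (a + d) (b + d)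
  | rdiv r a b => rdiv (r + d) (a + d) (b + d)
  | rload r A i => rload (r + d) (A + d) (i + d)
  | rstore A i a => rstore (A + d) (i + d) (a + d)

/-- Add `d` to the names of both registers compared, as `Instr.shift` does for instructions. -/
def Test.shift (d : ℕ) : Test → Test
  | ilt a b => ilt (a + d) (b + d)
  | rlt a b => rlt (a + d) (b + d)

/-- Relocate every instruction and test of a program by `d`. -/
def Prog.shift (d : ℕ) : Prog → Prog
  | skip => skip
  | instr e => instr (e.shift d)
  | seq p q => seq (p.shift d) (q.shift d)
  | branch c p q => branch (c.shift d) (p.shift d) (q.shift d)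
  | loop c p => loop (c.shift d) (p.shift d)

/-- The registers and arrays with names at least `d`, renamed to start from `0`: the memory that a
program relocated by `d` sees. -/
def State.high (d : ℕ) (s : State) : State where
  ireg r := s.ireg (r + d)
  rreg r := s.rreg (r + d)
  iarr A := s.iarr (A + d)
  rarr A := s.rarr (A + d)

/-- The registers and real arrays with names below `d` agree. -/
structure AgreeBelow (d : ℕ) (s s' : State) : Prop where
  ireg : ∀ r < d, s'.ireg r = s.ireg r
  rreg : ∀ r < d, s'.rreg r = s.rreg r
  rarr : ∀ A < d, s'.rarr A = s.rarr A

theorem AgreeBelow.refl (d : ℕ) (s : State) : AgreeBelow d s s :=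
  ⟨fun _ _ => rfl, fun _ _ => rfl, fun _ _ => rfl⟩

theorem AgreeBelow.trans {d : ℕ} {s₁ s₂ s₃ : State} (h : AgreeBelow d s₁ s₂)
    (h' : AgreeBelow d s₂ s₃) : AgreeBelow d s₁ s₃ :=
  ⟨fun r hr => (h'.ireg r hr).trans (h.ireg r hr), fun r hr => (h'.rreg r hr).trans (h.rreg r hr),
    fun A hA => (h'.rarr A hA).trans (h.rarr A hA)⟩

theorem update_comp_add {α : Type*} (f : ℕ → α) (d r : ℕ) (v : α) :
    (fun q => Function.update f (r + d) v (q + d)) = Function.update (fun q => f (q + d)) r v := by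
  funext q
  simp [Function.update_apply]

theorem Instr.high_apply_shift (e : Instr) (d : ℕ) (s : State) :
    ((e.shift d).apply s).high d = e.apply (s.high d) := by
  cases e <;>
    simp [Instr.shift, Instr.apply, State.high, State.setI, State.setR, State.setIArr,
      State.setRArr, update_comp_add]

theorem Instr.agreeBelow_apply_shift (e : Instr) (d : ℕ) (s : State) :
    AgreeBelow d s ((e.shift d).apply s) := by
  have ne_add {q : ℕ} (r : ℕ) (hq : q < d) : q ≠ r + d := by lia
  cases e <;> constructor <;> intro q hq <;>
    simp [Instr.shift, Instr.apply, State.setI, State.setR, State.setIArr, State.setRArr,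
      Function.update_of_ne, ne_add, hq]

theorem Test.holds_shift (c : Test) (d : ℕ) (s : State) :
    (c.shift d).Holds s ↔ c.Holds (s.high d) := by
  cases c <;> rfl

theorem Exec.shift {p : Prog} {σ σ' : State} {t : ℕ} (h : Exec p σ t σ') {d : ℕ} {s : State}
    (hs : s.high d = σ) :
    ∃ s', Exec (p.shift d) s t s' ∧ s'.high d = σ' ∧ AgreeBelow d s s' := by
  induction h generalizing s with
  | skip => exact ⟨s, .skip _, hs, .refl _ _⟩
  | instr e =>
    subst hs
    exact ⟨_, .instr _ _, e.high_apply_shift d s, e.agreeBelow_apply_shift d s⟩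
  | seq _ _ ih₁ ih₂ =>
    obtain ⟨s₁, hp, hhigh₁, hlow₁⟩ := ih₁ hs
    obtain ⟨s₂, hq, hhigh₂, hlow₂⟩ := ih₂ hhigh₁
    exact ⟨s₂, .seq hp hq, hhigh₂, hlow₁.trans hlow₂⟩
  | branchTrue hc _ ih =>
    obtain ⟨s₁, hp, hhigh, hlow⟩ := ih hs
    subst hs
    exact ⟨s₁, .branchTrue ((Test.holds_shift _ _ _).2 hc) hp, hhigh, hlow⟩
  | branchFalse hc _ ih =>
    obtain ⟨s₁, hq, hhigh, hlow⟩ := ih hs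
    subst hs
    exact ⟨s₁, .branchFalse (mt (Test.holds_shift _ _ _).1 hc) hq, hhigh, hlow⟩
  | loopTrue hc _ _ ih₁ ih₂ =>
    obtain ⟨s₁, hp, hhigh₁, hlow₁⟩ := ih₁ hs
    obtain ⟨s₂, hloop, hhigh₂, hlow₂⟩ := ih₂ hhigh₁
    subst hs
    exact ⟨s₂, .loopTrue ((Test.holds_shift _ _ _).2 hc) hp hloop, hhigh₂, hlow₁.trans hlow₂⟩
  | loopFalse hc =>
    subst hs
    exact ⟨s, .loopFalse (mt (Test.holds_shift _ _ _).1 hc), rfl, .refl _ _⟩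

/-! ### Total correctness with a time bound -/

/-- Total correctness with a time bound: started in `s`, the program `p` halts within `T` steps in
a state that satisfies `Q`. -/
def Runs (p : Prog) (s : State) (T : ℕ) (Q : State → Prop) : Prop :=
  ∃ t s', Exec p s t s' ∧ t ≤ T ∧ Q s'

/-- A straight-line program. -/
def Prog.block : List Instr → Prog
  | [] => .skip
  | e :: l => .seq (.instr e) (block l)

/-- The programs of a list, one after the other. -/
def Prog.seqs : List Prog → Prog
  | [] => .skip
  | p :: l => .seq p (seqs l)

/-- The loop `for c from 0 to b - 1`, where `c` and `b` are index registers. Register `c + 1` holds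
`n` times the counter; the constants `n` and `1` are expected in the index registers `0` and `2`. -/
def Prog.forRange (c b : ℕ) (body : Prog) : Prog :=
  .seq (.block [.iconst c 0, .iconst (c + 1) 0])
    (.loop (.ilt c b) (.seq body (.block [.iadd c c 2, .iadd (c + 1) (c + 1) 0])))

section Runs

variable {p q : Prog} {s : State} {T T₁ T₂ : ℕ} {Q R : State → Prop}

theorem Runs.mono (h : Runs p s T₁ R) (hT : T₁ ≤ T₂) (hQ : ∀ s', R s' → Q s') : Runs p s T₂ Q := by
  obtain ⟨t, s', hex, ht, hR⟩ := h
  exact ⟨t, s', hex, ht.trans hT, hQ _ hR⟩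

theorem Runs.skip (h : Q s) : Runs .skip s 1 Q :=
  ⟨1, s, .skip _, le_rfl, h⟩

theorem Runs.instr {e : Instr} (h : Q (e.apply s)) : Runs (.instr e) s 1 Q :=
  ⟨1, _, .instr _ _, le_rfl, h⟩

theorem Runs.seq (h : Runs p s T₁ R) (h' : ∀ s', R s' → Runs q s' T₂ Q) :
    Runs (.seq p q) s (T₁ + T₂) Q := by
  obtain ⟨t, s', hp, ht, hR⟩ := h
  obtain ⟨t', s'', hq, ht', hQ⟩ := h' s' hR
  exact ⟨_, _, .seq hp hq, Nat.add_le_add ht ht', hQ⟩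

theorem Runs.branch {c : Test} (hp : c.Holds s → Runs p s T Q) (hq : ¬ c.Holds s → Runs q s T Q) :
    Runs (.branch c p q) s (1 + T) Q := by
  by_cases hc : c.Holds s
  · obtain ⟨t, s', hex, ht, hQ⟩ := hp hc
    exact ⟨_, _, .branchTrue hc hex, Nat.add_le_add_left ht 1, hQ⟩
  · obtain ⟨t, s', hex, ht, hQ⟩ := hq hc
    exact ⟨_, _, .branchFalse hc hex, Nat.add_le_add_left ht 1, hQ⟩

theorem Runs.guard {c : Test} (hT : 0 < T) (hskip : c.Holds s → Q s)
    (hp : ¬ c.Holds s → Runs p s T Q) : Runs (.branch c .skip p) s (1 + T) Q :=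
  .branch (fun hc => (Runs.skip (hskip hc)).mono hT fun _ => id) hp

theorem Runs.block {l : List Instr} (h : Q (l.foldl (fun s e => e.apply s) s)) :
    Runs (.block l) s (l.length + 1) Q := by
  induction l generalizing s with
  | nil => exact .skip h
  | cons e l ih =>
    refine (Runs.seq (R := fun s' => s' = e.apply s) (.instr rfl) ?_).mono
      (T₁ := 1 + (l.length + 1)) (by simp; lia) (fun _ => id)
    rintro s' rfl
    exact ih h

theorem Runs.loop {c : Test} {m : ℕ} {I : ℕ → State → Prop}
    (hstep : ∀ j < m, ∀ s, I j s → c.Holds s ∧ Runs p s T (I (j + 1)))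
    (hend : ∀ s, I m s → ¬ c.Holds s) (h0 : I 0 s) :
    Runs (.loop c p) s (m * (1 + T) + 1) (I m) := by
  suffices H : ∀ r ≤ m, ∀ s, I (m - r) s → Runs (.loop c p) s (r * (1 + T) + 1) (I m) from
    H m le_rfl s (by simpa using h0)
  intro r
  induction r with
  | zero => exact fun _ s hs => ⟨1, s, .loopFalse (hend s hs), by lia, hs⟩
  | succ r ih =>
    intro hr s hs
    obtain ⟨hc, t, s', hp, ht, hI⟩ := hstep (m - (r + 1)) (by lia) s hs
    rw [show m - (r + 1) + 1 = m - r by lia] at hI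
    obtain ⟨t', s'', hloop, ht', hIm⟩ := ih (by lia) s' hI
    exact ⟨_, _, .loopTrue hc hp hloop, by lia, hIm⟩

theorem Runs.forRange {c b m n : ℕ} {I : ℕ → State → Prop} (hc : 0 < c)
    (hI : ∀ j s x y, I j s → I j ((s.setI c x).setI (c + 1) y))
    (hreg : ∀ j s, I j s → s.ireg b = m ∧ s.ireg 0 = n ∧ s.ireg 2 = 1)
    (hbody : ∀ j < m, ∀ s, I j s → s.ireg c = j → s.ireg (c + 1) = j * n →
      Runs p s T fun s' => I (j + 1) s' ∧ s'.ireg c = j ∧ s'.ireg (c + 1) = j * n)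
    (h0 : I 0 s) :
    Runs (.forRange c b p) s (m * (T + 4) + 4) fun s' => I m s' ∧ s'.ireg (c + 1) = m * n := by
  let J (j : ℕ) (s : State) : Prop := I j s ∧ s.ireg c = j ∧ s.ireg (c + 1) = j * n
  have hinit : Runs (.block [.iconst c 0, .iconst (c + 1) 0]) s 3 (J 0) :=
    .block ⟨hI _ _ _ _ h0, by simp [Instr.apply], by simp [Instr.apply]⟩
  have hloop {s : State} (hs : J 0 s) :
      Runs (.loop (.ilt c b) (.seq p (.block [.iadd c c 2, .iadd (c + 1) (c + 1) 0]))) s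
        (m * (1 + (T + 3)) + 1) (J m) := by
    refine .loop (fun j hj s hs => ⟨?_, ?_⟩) (fun s hs => ?_) hs
    · simpa [Test.Holds, hs.2.1, hreg j s hs.1] using hj
    · refine .seq (hbody j hj s hs.1 hs.2.1 hs.2.2) fun s' ⟨hs', hcount, hmul⟩ =>
        .block ⟨?_, ?_, ?_⟩
      · exact hI _ _ _ _ hs'
      · simp [Instr.apply, hcount, hreg _ _ hs']
      · simp [Instr.apply, hmul, hreg _ _ hs', hc.ne, add_mul]
    · simp [Test.Holds, hs.2.1, hreg m s hs.1]
  exact (hinit.seq fun _ => hloop).mono (by lia) fun s' hs' => ⟨hs'.1, hs'.2.2⟩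

end Runs

/-! ### Computing in scratch registers -/

/-- From `s` to `s'`, only the registers with names in `[c, 40)` have changed. Everything from name
`40` on is the memory of the relocated rectangle algorithm. -/
structure ScratchEq (c : ℕ) (s s' : State) : Prop where
  ireg : ∀ r < c, s'.ireg r = s.ireg r
  rreg : ∀ r < c, s'.rreg r = s.rreg r
  rarr : s'.rarr = s.rarr
  high : s'.high 40 = s.high 40

/-- The instruction only writes to a register with name in `[c, 40)`. -/
def Instr.IsScratch (c : ℕ) : Instr → Prop
  | iconst r _ | iadd r _ _ | isub r _ _ | iload r _ _ | rconst r _ | rcast r _ | radd r _ _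
  | rsub r _ _ | rmul r _ _ | rdiv r _ _ | rload r _ _ => c ≤ r ∧ r < 40
  | istore _ _ _ | rstore _ _ _ => False

namespace ScratchEq

variable {c d : ℕ} {s s₁ s₂ s₃ : State}

protected theorem refl : ScratchEq c s s :=
  ⟨fun _ _ => rfl, fun _ _ => rfl, rfl, rfl⟩

theorem trans (h : ScratchEq c s₁ s₂) (h' : ScratchEq c s₂ s₃) : ScratchEq c s₁ s₃ :=
  ⟨fun r hr => (h'.ireg r hr).trans (h.ireg r hr), fun r hr => (h'.rreg r hr).trans (h.rreg r hr),
    h'.rarr.trans h.rarr, h'.high.trans h.high⟩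

theorem mono (h : ScratchEq d s₁ s₂) (hcd : c ≤ d) : ScratchEq c s₁ s₂ :=
  ⟨fun r hr => h.ireg r (hr.trans_le hcd), fun r hr => h.rreg r (hr.trans_le hcd), h.rarr, h.high⟩

theorem apply {e : Instr} (he : e.IsScratch c) : ScratchEq c s (e.apply s) := by
  have ne_of_lt {q r : ℕ} (hr : c ≤ r ∧ r < 40) (hq : q < c) : q ≠ r := by lia
  have ne_add {r : ℕ} (hr : c ≤ r ∧ r < 40) (q : ℕ) : q + 40 ≠ r := by lia
  cases e <;> simp only [Instr.IsScratch] at he <;> constructor <;>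
    simp +contextual [Instr.apply, State.high, ne_of_lt he, ne_add he]

theorem foldl_apply {l : List Instr} (hl : ∀ e ∈ l, e.IsScratch c) :
    ScratchEq c s (l.foldl (fun s e => e.apply s) s) := by
  induction l generalizing s with
  | nil => exact .refl
  | cons e l ih =>
    rw [List.forall_mem_cons] at hl
    exact (apply hl.1).trans (ih hl.2)

theorem setI {r v : ℕ} (hr : c ≤ r) (hr' : r < 40) : ScratchEq c s (s.setI r v) :=
  apply (e := .iconst r v) ⟨hr, hr'⟩

end ScratchEq

theorem Runs.sumRange {p : Prog} {s : State} {T c b m n z : ℕ} {f : ℕ → ℝ}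
    (hc : 2 < c) (hbc : b < c) (hc' : c + 1 < 40) (hm : s.ireg b = m) (hn : s.ireg 0 = n)
    (hone : s.ireg 2 = 1)
    (hbody : ∀ j < m, ∀ s', ScratchEq c s s' → s'.ireg c = j → s'.ireg (c + 1) = j * n →
      Runs p s' T fun s'' => ScratchEq (c + 2) s' s'' ∧ s''.rreg z = s'.rreg z + f j) :
    Runs (.forRange c b p) s (m * (T + 4) + 4) fun s' =>
      ScratchEq c s s' ∧ s'.rreg z = s.rreg z + ∑ j ∈ Finset.range m, f j := by
  refine (Runs.forRange (m := m) (n := n) (T := T) (I := fun j s' => ScratchEq c s s' ∧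
    s'.rreg z = s.rreg z + ∑ i ∈ Finset.range j, f i) (by lia) ?_ ?_ ?_ ?_).mono le_rfl
    fun s' hs' => hs'.1
  · exact fun j s' x y hs' => ⟨hs'.1.trans ((ScratchEq.setI le_rfl (by lia)).trans
      (.setI (by lia) hc')), by simpa using hs'.2⟩
  · exact fun j s' hs' => ⟨hm ▸ hs'.1.ireg b hbc, hn ▸ hs'.1.ireg 0 (by lia),
      hone ▸ hs'.1.ireg 2 hc⟩
  · refine fun j hj s' hs' hj' hjn => (hbody j hj s' hs'.1 hj' hjn).mono le_rfl fun s'' hs'' => ?_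
    refine ⟨⟨hs'.1.trans (hs''.1.mono (by lia)), ?_⟩, hj' ▸ hs''.1.ireg c (by lia),
      hjn ▸ hs''.1.ireg (c + 1) (by lia)⟩
    rw [hs''.2, hs'.2, Finset.sum_range_succ, add_assoc]
  · exact ⟨.refl, by simp⟩

/-- Compute `n ^ e` in index register `r`. There is no multiplication of indices, but a loop over
`n ^ e` values leaves `n ^ e * n` in the second register of `Prog.forRange`. -/
def powProg (r : ℕ) : ℕ → Prog
  | 0 => .block [.iconst r 1]
  | e + 1 => .seq (powProg r e) (.seq (.forRange (r + 1) r .skip)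
      (.block [.iconst (r + 1) 0, .iadd r (r + 2) (r + 1)]))

theorem runs_powProg {r e n : ℕ} {s : State} (hr : 2 < r) (hr' : r + 2 < 40) (hn : s.ireg 0 = n)
    (hpos : 0 < n) (hone : s.ireg 2 = 1) : Runs (powProg r e) s ((13 * e + 2) * n ^ e) fun s' =>
      ScratchEq r s s' ∧ s'.ireg r = n ^ e := by
  induction e with
  | zero => exact .block ⟨.foldl_apply (by simp [Instr.IsScratch]; lia), by simp [Instr.apply]⟩
  | succ e ih =>
    have hloop {s₁ : State} (hs₁ : ScratchEq r s s₁ ∧ s₁.ireg r = n ^ e) :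
        Runs (.forRange (r + 1) r .skip) s₁ (n ^ e * (1 + 4) + 4) fun s₂ =>
          ScratchEq (r + 1) s₁ s₂ ∧ s₂.ireg (r + 1 + 1) = n ^ e * n := by
      refine .forRange (I := fun _ => ScratchEq (r + 1) s₁) (by lia) (fun _ s' x y hs' => ?_)
        (fun _ s' hs' => ?_) (fun _ _ s' hs' hj' hjn => .skip ⟨hs', hj', hjn⟩) .refl
      · exact hs'.trans ((ScratchEq.setI le_rfl (by lia)).trans (.setI (by lia) (by lia)))
      · simp [hs'.ireg r, hs'.ireg 0, hs'.ireg 2 (by lia), hs₁.1.ireg, hs₁.2, hr,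
          show 0 < r by lia, hn, hone]
    refine (ih.seq fun s₁ hs₁ => (hloop hs₁).seq fun s₂ hs₂ =>
      .block (Q := fun s' => ScratchEq r s s' ∧ s'.ireg r = n ^ (e + 1)) ⟨?_, ?_⟩).mono ?_
        fun _ => id
    · exact hs₁.1.trans ((hs₂.1.mono (by lia)).trans
        (.foldl_apply (by simp [Instr.IsScratch]; lia)))
    · simpa [Instr.apply, pow_succ] using hs₂.2
    · have hpow : 0 < n ^ e := by positivity
      have hle : n ^ e ≤ n ^ (e + 1) := Nat.pow_le_pow_right hpos (by lia)
      simp only [List.length_cons, List.length_nil]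
      nlinarith

end RealRAM

/-! ### Writing down the points -/

/-- A point of the plane together with its weight. -/
abbrev WeightedPoint : Type := (ℝ × ℝ) × ℝ

/-- The input of Max-Weight Rectangle given by a list of weighted points. -/
noncomputable def listInput (l : List WeightedPoint) : RealRAM.State :=
  rectangleInput (fun i : Fin l.length => l[i].1) (fun i => l[i].2)

open RealRAM

theorem listInput_concat (l : List WeightedPoint) (p : WeightedPoint) :
    listInput (l ++ [p]) = ((((listInput l).setRArr 0 l.length p.1.1).setRArr 1 l.length
      p.1.2).setRArr 2 l.length p.2).setI 0 (l.length + 1) := by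
  simp only [listInput, rectangleInput, State.setRArr, State.setI, State.mk.injEq, true_and]
  constructor
  · ext r
    simp only [Function.update_apply, List.length_append, List.length_singleton]
    grind
  · ext A i
    simp only [Function.update_apply]
    grind

namespace RealRAM

/-- The points `l` have been written down: once as the input of the rectangle algorithm, relocated
by `40`, and once in the real arrays `1`, `2`, `3`, since the algorithm may destroy its input. Index
register `1` holds their number. -/
structure PointBuffer (l : List WeightedPoint) (s : State) : Prop where
  length : s.ireg 1 = l.length
  fst : ∀ (i : ℕ) (hi : i < l.length), s.rarr 1 i = l[i].1.1
  snd : ∀ (i : ℕ) (hi : i < l.length), s.rarr 2 i = l[i].1.2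
  weight : ∀ (i : ℕ) (hi : i < l.length), s.rarr 3 i = l[i].2
  high : s.high 40 = listInput l

/-- From `s` to `s'`, the graph in the real array `0` and the registers with names below `c` are
unchanged, except for the number of points written down in index register `1`. -/
structure Frame (c : ℕ) (s s' : State) : Prop where
  ireg : ∀ r < c, r ≠ 1 → s'.ireg r = s.ireg r
  rreg : ∀ r < c, s'.rreg r = s.rreg r
  graph : s'.rarr 0 = s.rarr 0

/-- From `s` to `s'`, the points `l` have been written down, besides computing in registers with
names at least `c`. -/
structure Appends (c : ℕ) (l : List WeightedPoint) (s s' : State) : Prop extends Frame c s s' where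
  buffer : ∀ l₀, PointBuffer l₀ s → PointBuffer (l₀ ++ l) s'

section Append

variable {c d : ℕ} {s s₁ s₂ s₃ : State} {l l₁ l₂ : List WeightedPoint}

theorem Frame.trans (h : Frame c s₁ s₂) (h' : Frame c s₂ s₃) : Frame c s₁ s₃ :=
  ⟨fun r hr hr1 => (h'.ireg r hr hr1).trans (h.ireg r hr hr1),
    fun r hr => (h'.rreg r hr).trans (h.rreg r hr), h'.graph.trans h.graph⟩

theorem Frame.mono (h : Frame d s₁ s₂) (hcd : c ≤ d) : Frame c s₁ s₂ :=
  ⟨fun r hr => h.ireg r (hr.trans_le hcd), fun r hr => h.rreg r (hr.trans_le hcd), h.graph⟩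

theorem Appends.trans (h : Appends c l₁ s₁ s₂) (h' : Appends c l₂ s₂ s₃) :
    Appends c (l₁ ++ l₂) s₁ s₃ :=
  ⟨h.toFrame.trans h'.toFrame, fun l₀ hl₀ => by
    rw [← List.append_assoc]
    exact h'.buffer _ (h.buffer l₀ hl₀)⟩

theorem Appends.mono (h : Appends d l s₁ s₂) (hcd : c ≤ d) : Appends c l s₁ s₂ :=
  ⟨h.toFrame.mono hcd, h.buffer⟩

theorem ScratchEq.appends_nil (h : ScratchEq c s s') (hc : 1 < c) : Appends c [] s s' where
  ireg r hr _ := h.ireg r hr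
  rreg := h.rreg
  graph := congrFun h.rarr 0
  buffer l₀ hl₀ := by
    rw [List.append_nil]
    exact ⟨by rw [h.ireg 1 hc, hl₀.length], by simpa only [h.rarr] using hl₀.fst,
      by simpa only [h.rarr] using hl₀.snd, by simpa only [h.rarr] using hl₀.weight,
      h.high.trans hl₀.high⟩

variable {p q : Prog} {T T₁ T₂ : ℕ}

theorem Runs.append (h : Runs p s T₁ (Appends c l₁ s))
    (h' : ∀ s', Frame c s s' → Runs q s' T₂ (Appends c l₂ s')) :
    Runs (.seq p q) s (T₁ + T₂) (Appends c (l₁ ++ l₂) s) :=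
  h.seq fun s' hs' => (h' s' hs'.toFrame).mono le_rfl fun _ hs'' => hs'.trans hs''

theorem Runs.flatMapSeqs {ι : Type*} {L : List ι} {prog : ι → Prog}
    {points : ι → List WeightedPoint}
    (h : ∀ x ∈ L, ∀ s', Frame c s s' → Runs (prog x) s' T (Appends c (points x) s')) (hc : 1 < c) :
    Runs (.seqs (L.map prog)) s (L.length * T + 1) (Appends c (L.flatMap points) s) := by
  induction L generalizing s with
  | nil => exact (Runs.skip (ScratchEq.refl.appends_nil hc)).mono (by simp) fun _ => id
  | cons x L ih =>
    rw [List.forall_mem_cons] at h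
    refine (Runs.append (h.1 s (ScratchEq.refl.appends_nil hc).toFrame) fun s' hs' =>
      ih fun y hy s'' hs'' => h.2 y hy s'' (hs'.trans hs'')).mono ?_ fun _ => id
    rw [List.length_cons]
    lia

theorem Runs.flatMapRange {b m n : ℕ} {points : ℕ → List WeightedPoint} (hc : 2 < c) (hbc : b < c)
    (hb : b ≠ 1) (hc' : c + 1 < 40) (hm : s.ireg b = m) (hn : s.ireg 0 = n) (hone : s.ireg 2 = 1)
    (hbody : ∀ j < m, ∀ s', Frame c s s' → s'.ireg c = j → s'.ireg (c + 1) = j * n →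
      Runs p s' T (Appends (c + 2) (points j) s')) :
    Runs (.forRange c b p) s (m * (T + 4) + 4) (Appends c ((List.range m).flatMap points) s) := by
  refine (Runs.forRange (m := m) (n := n) (T := T)
    (I := fun j s' => Appends c ((List.range j).flatMap points) s s') (by lia) ?_ ?_ ?_ ?_).mono
    le_rfl fun s' hs' => hs'.1
  · intro j s' x y hs'
    simpa using hs'.trans (((ScratchEq.setI le_rfl (by lia)).trans
      (.setI (by lia) hc')).appends_nil (by lia))
  · exact fun j s' hs' => ⟨hm ▸ hs'.ireg b hbc hb, hn ▸ hs'.ireg 0 (by lia) (by lia),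
      hone ▸ hs'.ireg 2 hc (by lia)⟩
  · refine fun j hj s' hs' hj' hjn => (hbody j hj s' hs'.toFrame hj' hjn).mono le_rfl
      fun s'' hs'' => ⟨?_, hj' ▸ hs''.ireg c (by lia) (by lia),
        hjn ▸ hs''.ireg (c + 1) (by lia) (by lia)⟩
    rw [List.range_succ, List.flatMap_append, List.flatMap_singleton]
    exact hs'.trans (hs''.mono (by lia))
  · exact ScratchEq.refl.appends_nil (by lia)

end Append

/-- Write down the point whose coordinates and weight are in the real registers `x`, `y`, `w`. -/
def emitProg (x y w : ℕ) : Prog :=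
  .block [.rstore 1 1 x, .rstore 2 1 y, .rstore 3 1 w, .rstore 40 1 x, .rstore 41 1 y,
    .rstore 42 1 w, .iadd 1 1 2, .iadd 40 40 2]

section Emit

variable {d r A : ℕ} (s : State) (i v : ℕ) (x : ℝ)

theorem State.high_setI_of_le (h : d ≤ r) : (s.setI r v).high d = (s.high d).setI (r - d) v := by
  obtain ⟨r, rfl⟩ := Nat.exists_eq_add_of_le' h
  simp [State.high, State.setI, update_comp_add]

theorem State.high_setI_of_lt (h : r < d) : (s.setI r v).high d = s.high d := by
  simp only [State.high, State.mk.injEq, State.setI_rreg, State.setI_iarr, State.setI_rarr,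
    and_self, and_true]
  ext q
  simp [show q + d ≠ r by lia]

theorem State.high_setRArr_of_le (h : d ≤ A) :
    (s.setRArr A i x).high d = (s.high d).setRArr (A - d) i x := by
  obtain ⟨A, rfl⟩ := Nat.exists_eq_add_of_le' h
  simp [State.high, State.setRArr, update_comp_add]

theorem State.high_setRArr_of_lt (h : A < d) : (s.setRArr A i x).high d = s.high d := by
  simp only [State.high, State.mk.injEq]
  refine ⟨rfl, rfl, rfl, ?_⟩
  ext B
  simp [show B + d ≠ A by lia]

theorem update_length_eq_getElem_concat {α β : Type*} {l : List α} {f : ℕ → β} (g : α → β) (a : α)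
    (hf : ∀ (i : ℕ) (hi : i < l.length), f i = g l[i]) (i : ℕ) (hi : i < (l ++ [a]).length) :
    Function.update f l.length (g a) i = g (l ++ [a])[i] := by
  grind [Function.update_apply]

variable {s}

theorem runs_emitProg {x y w c : ℕ} (hc : c ≤ 40) (hone : s.ireg 2 = 1) :
    Runs (emitProg x y w) s 9 (Appends c [((s.rreg x, s.rreg y), s.rreg w)] s) := by
  refine .block ⟨⟨fun r hr hr1 => ?_, fun r _ => by simp [Instr.apply], by simp [Instr.apply]⟩,
    fun l hl => ?_⟩
  · simp [Instr.apply, hr1, (hr.trans_le hc).ne]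
  have hlen : s.ireg 40 = l.length := by
    simpa [State.high, listInput, rectangleInput] using congrArg (State.ireg · 0) hl.high
  let point : WeightedPoint := ((s.rreg x, s.rreg y), s.rreg w)
  constructor
  · simp [Instr.apply, hl.length, hone]
  · simpa [Instr.apply, hl.length] using update_length_eq_getElem_concat
      (fun p : WeightedPoint => p.1.1) point hl.fst
  · simpa [Instr.apply, hl.length] using update_length_eq_getElem_concat
      (fun p : WeightedPoint => p.1.2) point hl.snd
  · simpa [Instr.apply, hl.length] using update_length_eq_getElem_concat
      (fun p : WeightedPoint => p.2) point hl.weight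
  · rw [listInput_concat, ← hl.high]
    simp [Instr.apply, hone, hlen, hl.length, State.high_setI_of_le, State.high_setI_of_lt,
      State.high_setRArr_of_le, State.high_setRArr_of_lt]

end Emit

end RealRAM

/-! ### Gadgets of points -/

open Classical in
/-- Total weight of the points of a list in the closed box with corners `lo` and `hi`, as
`boxWeight` for families. -/
noncomputable def boxSum (l : List WeightedPoint) (lo hi : ℝ × ℝ) : ℝ :=
  (l.map fun p => if p.1 ∈ Set.Icc lo hi then p.2 else 0).sum

/-- A rectangle of four points of alternating weights `±g`, which cancel in a box unless the box
separates the corner `(x, y)` from its two neighbours. -/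
def quad (x X y Y g : ℝ) : List WeightedPoint :=
  [((x, y), g), ((x + X, y), -g), ((x, y + Y), -g), ((x + X, y + Y), g)]

/-- The quads at the grid points whose coordinates have the last base-`n` digits `u` and `v`. -/
noncomputable def cellPoints (n A B : ℕ) (X Y : ℝ) (u v : ℕ) (g : ℝ) : List WeightedPoint :=
  (List.range A).flatMap fun α => (List.range B).flatMap fun β =>
    quad (((α * n + u : ℕ) : ℝ) * X) X (((β * n + v : ℕ) : ℝ) * Y) Y g

section BoxSum

variable {l l₁ l₂ : List WeightedPoint} {lo hi : ℝ × ℝ}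

theorem boxWeight_eq_boxSum :
    boxWeight (fun i : Fin l.length => l[i].1) (fun i => l[i].2) lo hi = boxSum l lo hi := by
  rw [boxWeight, boxSum, Finset.sum_filter, ← List.sum_ofFn]
  congr 1
  exact List.ofFn_getElem_eq_map l fun p : WeightedPoint => if p.1 ∈ Set.Icc lo hi then p.2 else 0

open Classical in
theorem boxSum_singleton (p : WeightedPoint) :
    boxSum [p] lo hi = if p.1 ∈ Set.Icc lo hi then p.2 else 0 := by
  simp [boxSum]

theorem boxSum_append : boxSum (l₁ ++ l₂) lo hi = boxSum l₁ lo hi + boxSum l₂ lo hi := by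
  simp [boxSum]

theorem boxSum_flatMap {ι : Type*} (L : List ι) (f : ι → List WeightedPoint) :
    boxSum (L.flatMap f) lo hi = (L.map fun x => boxSum (f x) lo hi).sum := by
  induction L with
  | nil => simp [boxSum]
  | cons x L ih => rw [List.flatMap_cons, boxSum_append, ih, List.map_cons, List.sum_cons]

theorem boxSum_flatMap_range (m : ℕ) (f : ℕ → List WeightedPoint) :
    boxSum ((List.range m).flatMap f) lo hi = ∑ i ∈ Finset.range m, boxSum (f i) lo hi := by
  rw [boxSum_flatMap]
  rfl

theorem boxSum_le {M : ℝ} (hM : 0 ≤ M) (h : ∀ p ∈ l, p.2 ≤ M) : boxSum l lo hi ≤ l.length * M := by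
  rw [boxSum, ← nsmul_eq_mul, ← List.length_map (as := l)]
  refine List.sum_le_card_nsmul _ M fun y hy => ?_
  obtain ⟨p, hp, rfl⟩ := List.mem_map.1 hy
  split_ifs
  exacts [h p hp, hM]

theorem boxSum_quad {p q i j : ℕ} {X Y g : ℝ}
    (hX : ∀ i : ℕ, (lo.1 ≤ i * X ∧ i * X ≤ hi.1) ↔ i ≤ p)
    (hY : ∀ j : ℕ, (lo.2 ≤ j * Y ∧ j * Y ≤ hi.2) ↔ j ≤ q) :
    boxSum (quad (i * X) X (j * Y) Y g) lo hi = if i = p ∧ j = q then g else 0 := by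
  have hmem (i j : ℕ) : ((i * X, j * Y) ∈ Set.Icc lo hi) ↔ (i ≤ p ∧ j ≤ q) := by
    rw [← hX, ← hY, Set.mem_Icc, Prod.le_def, Prod.le_def]
    tauto
  have hXsucc : (i : ℝ) * X + X = ((i + 1 : ℕ) : ℝ) * X := by push_cast; ring
  have hYsucc : (j : ℝ) * Y + Y = ((j + 1 : ℕ) : ℝ) * Y := by push_cast; ring
  simp only [boxSum, quad, hXsucc, hYsucc, List.map_cons, List.map_nil, List.sum_cons,
    List.sum_nil, hmem]
  rcases lt_trichotomy i p with hi | hi | hi <;> rcases lt_trichotomy j q with hj | hj | hj <;>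
    (split_ifs <;> first | lia | simp)

theorem mul_add_eq_iff_div_mod {n α u p : ℕ} (hu : u < n) :
    α * n + u = p ↔ α = p / n ∧ p % n = u := by
  rw [eq_comm (a := α), Nat.div_mod_unique (Nat.zero_lt_of_lt hu), mul_comm, add_comm]
  simp [hu]

theorem boxSum_cellPoints {n p q A B u v : ℕ} {X Y g : ℝ}
    (hX : ∀ i : ℕ, (lo.1 ≤ i * X ∧ i * X ≤ hi.1) ↔ i ≤ p)
    (hY : ∀ j : ℕ, (lo.2 ≤ j * Y ∧ j * Y ≤ hi.2) ↔ j ≤ q) (hu : u < n) (hv : v < n) :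
    boxSum (cellPoints n A B X Y u v g) lo hi =
      if (p < A * n ∧ p % n = u) ∧ (q < B * n ∧ q % n = v) then g else 0 := by
  have hn : 0 < n := Nat.zero_lt_of_lt hu
  simp only [cellPoints, boxSum_flatMap_range, boxSum_quad hX hY, mul_add_eq_iff_div_mod hu,
    mul_add_eq_iff_div_mod hv]
  by_cases hp : p % n = u <;> by_cases hq : q % n = v <;>
    simp [hp, hq, ite_and, Nat.div_lt_iff_lt_mul hn]

end BoxSum

/-! ### The digits of a box -/

/-- How far an interval around the origin reaches on the negative (for even `a`) or the positive
(for odd `a`) half-line. -/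
noncomputable def reach (lo hi : ℝ) (a : ℕ) : ℝ := if Even a then -lo else hi

/-- The orientation of the half-line that `reach` measures. -/
def axisSign (a : ℕ) : ℤ := if Even a then -1 else 1

/-- The width of the grid on which an interval shows its `a`-th digit. -/
noncomputable def axisStep (n a : ℕ) : ℝ := axisSign a / ((n ^ (a / 2) : ℕ) * n)

/-- The number of positive multiples of `axisStep n a` in an interval around the origin. -/
noncomputable def axisPrefix (n : ℕ) (lo hi : ℝ) (a : ℕ) : ℕ :=
  ⌊reach lo hi a * (n ^ (a / 2) * n : ℕ)⌋₊

/-- The `a`-th digit of an interval around the origin is `u`. The two half-lengths of the interval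
are read as fractions in base `n`: one carries the digits with even index, the other those with odd
index. -/
def HasDigit (n : ℕ) (lo hi : ℝ) (a u : ℕ) : Prop :=
  axisPrefix n lo hi a < n ^ (a / 2) * n ∧ axisPrefix n lo hi a % n = u

noncomputable instance (n : ℕ) (lo hi : ℝ) (a u : ℕ) : Decidable (HasDigit n lo hi a u) :=
  inferInstanceAs (Decidable (_ ∧ _))

section Digits

variable {n : ℕ}

theorem HasDigit.iff_eq {lo hi : ℝ} {a : ℕ} {u v : Fin n} (h : HasDigit n lo hi a u) :
    HasDigit n lo hi a v ↔ v = u := by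
  rw [HasDigit, h.2, Fin.val_inj, eq_comm]
  exact and_iff_right h.1

theorem mul_axisStep_mem_iff {lo hi : ℝ} (hlo : lo ≤ 0) (hhi : 0 ≤ hi) (hn : 0 < n) (a j : ℕ) :
    (lo ≤ j * axisStep n a ∧ j * axisStep n a ≤ hi) ↔ j ≤ axisPrefix n lo hi a := by
  have hpos : (0 : ℝ) < (n ^ (a / 2) * n : ℕ) := by positivity
  have hfrac : (0 : ℝ) ≤ j / (n ^ (a / 2) * n : ℕ) := by positivity
  have hreach : 0 ≤ reach lo hi a := by unfold reach; split_ifs <;> linarith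
  have hstep : j * axisStep n a = axisSign a * (j / (n ^ (a / 2) * n : ℕ)) := by
    rw [axisStep, Nat.cast_mul]
    ring
  rw [axisPrefix, Nat.le_floor_iff (by positivity), ← div_le_iff₀ hpos, hstep]
  unfold reach axisSign
  split_ifs <;> grind

theorem exists_fraction_digits (d : ℕ → Fin n) (p : ℕ) : ∃ x : ℝ, 0 ≤ x ∧
    ∀ j < p, ⌊x * (n ^ j * n : ℕ)⌋₊ < n ^ j * n ∧ ⌊x * (n ^ j * n : ℕ)⌋₊ % n = d j := by
  have hn : (0 : ℝ) < n := by exact_mod_cast (d 0).pos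
  let N : Fin (n ^ p) := finFunctionFinEquiv fun i : Fin p => d i.rev
  refine ⟨N / (n : ℝ) ^ p, by positivity, fun j hj => ?_⟩
  have hpow : n ^ p = n ^ (p - 1 - j) * (n ^ j * n) := by
    rw [← pow_succ, ← pow_add]
    congr 1
    lia
  have hfloor : ⌊(N / (n : ℝ) ^ p) * (n ^ j * n : ℕ)⌋₊ = N / n ^ (p - 1 - j) := by
    rw [← Nat.floor_div_eq_div (K := ℝ)]
    congr 1
    have hpow' : (n : ℝ) ^ p = n ^ (p - 1 - j) * (n ^ j * n) := by exact_mod_cast hpow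
    push_cast
    rw [hpow']
    field_simp
  rw [hfloor]
  refine ⟨Nat.div_lt_of_lt_mul (hpow ▸ N.isLt), ?_⟩
  have hdigit := congrArg Fin.val
    (congrFun (finFunctionFinEquiv.symm_apply_apply fun i : Fin p => d i.rev) (Fin.rev ⟨j, hj⟩))
  rwa [Fin.rev_rev, finFunctionFinEquiv_symm_apply_val, Fin.val_rev,
    show p - (j + 1) = p - 1 - j by lia] at hdigit

theorem exists_interval_digits {k : ℕ} (z : Fin k → Fin n) :
    ∃ lo hi : ℝ, lo ≤ 0 ∧ 0 ≤ hi ∧ ∀ a : Fin k, HasDigit n lo hi a (z a) := by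
  rcases k with - | k
  · exact ⟨0, 0, le_rfl, le_rfl, (·.elim0)⟩
  obtain ⟨x, hx, hxdigit⟩ := exists_fraction_digits (fun j => z (Fin.ofNat _ (2 * j))) (k + 1)
  obtain ⟨y, hy, hydigit⟩ := exists_fraction_digits (fun j => z (Fin.ofNat _ (2 * j + 1))) (k + 1)
  refine ⟨-x, y, by simpa, hy, fun a => ?_⟩
  rw [← Fin.ofNat_val_eq_self a, Fin.val_ofNat, Nat.mod_eq_of_lt a.isLt]
  rcases Nat.even_or_odd' a with ⟨j, hj | hj⟩
  · simpa [HasDigit, axisPrefix, reach, hj] using hxdigit j (by lia)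
  · simpa [HasDigit, axisPrefix, reach, hj, show (2 * j + 1) / 2 = j by lia] using
      hydigit j (by lia)

end Digits

/-! ### Cliques as sequences of vertices -/

/-- The unordered pairs of distinct positions in a sequence of `k` vertices. -/
def digitPairs (k : ℕ) : Finset (Fin k × Fin k) := {x | x.1 < x.2}

section CliqueWeight

variable {k n : ℕ} {w : Fin n → Fin n → ℝ}

theorem two_mul_cliqueWeight (hw : ∀ i j, w i j = w j i) (S : Finset (Fin n)) :
    2 * cliqueWeight w S = ∑ x ∈ S.offDiag, w x.1 x.2 := by
  have hswap : ∑ i ∈ S, ∑ j ∈ S with j < i, w i j = cliqueWeight w S := by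
    simp only [cliqueWeight, Finset.sum_filter]
    rw [Finset.sum_comm]
    simp only [hw]
  have hsplit : S.offDiag = (S ×ˢ S).filter fun x => x.1 ≠ x.2 := by
    ext; simp [and_assoc]
  rw [two_mul]
  nth_rewrite 2 [← hswap]
  rw [cliqueWeight, hsplit, Finset.sum_filter, Finset.sum_product, ← Finset.sum_add_distrib]
  refine Finset.sum_congr rfl fun i _ => ?_
  rw [Finset.sum_filter, Finset.sum_filter, ← Finset.sum_add_distrib]
  refine Finset.sum_congr rfl fun j _ => ?_
  rcases lt_trichotomy i j with h | rfl | h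
  · simp [h, h.ne, h.not_gt]
  · simp
  · simp [h, h.ne', h.not_gt]

theorem cliqueWeight_map (hw : ∀ i j, w i j = w j i) (z : Fin k ↪ Fin n) (S : Finset (Fin k)) :
    cliqueWeight w (S.map z) = cliqueWeight (fun a b => w (z a) (z b)) S := by
  have hoff : (S.map z).offDiag = S.offDiag.map (z.prodMap z) := by
    ext ⟨u, v⟩
    simp
    grind [z.injective]
  have h := two_mul_cliqueWeight hw (S.map z)
  rw [hoff, Finset.sum_map] at h
  have h' := two_mul_cliqueWeight (w := fun a b => w (z a) (z b)) (fun _ _ => hw _ _) S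
  simpa [← h'] using h

theorem cliqueWeight_univ (w : Fin n → Fin n → ℝ) :
    cliqueWeight w Finset.univ = ∑ x ∈ digitPairs n, w x.1 x.2 := by
  simp only [cliqueWeight, digitPairs, Finset.sum_filter, Fintype.sum_prod_type]

theorem exists_map_univ_eq {S : Finset (Fin n)} (hS : S.card = k) :
    ∃ z : Fin k ↪ Fin n, Finset.univ.map z = S :=
  ⟨(S.orderEmbOfFin hS).toEmbedding, by simp⟩

theorem isNClique_top_iff {V : Type*} {S : Finset V} :
    (⊤ : SimpleGraph V).IsNClique k S ↔ S.card = k := by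
  rw [SimpleGraph.isNClique_iff]
  exact ⟨fun h => h.2, fun h => ⟨fun _ _ _ _ hne => hne, h⟩⟩

end CliqueWeight

/-! ### The reduction -/

section Reduction

variable {k n : ℕ}

/-- The interval products whose digits on either axis are the vertices `z`. The vertex with index
`a` occupies digit `a` of the horizontal interval, but digit `k - 1 - a` of the vertical one, so
that a gadget for the vertices with indices `a ≤ b` needs only about `n ^ (k / 2 + 1)` points. -/
def Encodes (lo hi : ℝ × ℝ) (z : Fin k → Fin n) : Prop :=
  ∀ a : Fin k, HasDigit n lo.1 hi.1 a (z a) ∧ HasDigit n lo.2 hi.2 a.rev (z a)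

/-- The weight of a pair of vertices in the reduction: that of their edge, or a penalty for
repeating a vertex. -/
noncomputable def cliqueEntry (w : Fin n → Fin n → ℝ) (M : ℝ) (u v : ℕ) : ℝ :=
  if u = v then -M else (cliqueInput w).rarr 0 (u * n + v)

/-- The gadget that rewards a box by `M` for encoding the same vertex with index `b` on both
axes. -/
noncomputable def vertexPoints (n : ℕ) (M : ℝ) (b : Fin k) : List WeightedPoint :=
  (List.range n).flatMap fun u => cellPoints n (n ^ (b / 2 : ℕ)) (n ^ (b.rev / 2 : ℕ))
    (axisStep n b) (axisStep n b.rev) u u M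

/-- The gadget that adds the weight of a pair of vertices of the encoded sequence. -/
noncomputable def edgePoints (w : Fin n → Fin n → ℝ) (M : ℝ) (x : Fin k × Fin k) :
    List WeightedPoint :=
  (List.range n).flatMap fun u => (List.range n).flatMap fun v =>
    cellPoints n (n ^ (x.1 / 2 : ℕ)) (n ^ (x.2.rev / 2 : ℕ)) (axisStep n x.1)
      (axisStep n x.2.rev) u v (cliqueEntry w M u v)

/-- The points to which a weighted graph is reduced, apart from the heavy point at the origin. -/
noncomputable def reductionPoints (k : ℕ) (w : Fin n → Fin n → ℝ) (M : ℝ) : List WeightedPoint :=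
  (digitPairs k).toList.flatMap (edgePoints w M) ++
    (Finset.univ : Finset (Fin k)).toList.flatMap (vertexPoints n M)

theorem exists_encodes (z : Fin k → Fin n) :
    ∃ lo hi : ℝ × ℝ, lo ≤ 0 ∧ 0 ≤ hi ∧ Encodes lo hi z := by
  obtain ⟨lo₁, hi₁, hlo₁, hhi₁, hz₁⟩ := exists_interval_digits z
  obtain ⟨lo₂, hi₂, hlo₂, hhi₂, hz₂⟩ := exists_interval_digits (z ∘ Fin.rev)
  exact ⟨(lo₁, lo₂), (hi₁, hi₂), ⟨hlo₁, hlo₂⟩, ⟨hhi₁, hhi₂⟩, fun a =>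
    ⟨hz₁ a, by simpa using hz₂ a.rev⟩⟩

theorem cliqueInput_entry (w : Fin n → Fin n → ℝ) (u v : Fin n) :
    (cliqueInput w).rarr 0 (u * n + v) = w u v := by
  have hlt : (u : ℕ) * n + v < n * n := by nlinarith [u.isLt, v.isLt]
  obtain ⟨hdiv, hmod⟩ := (mul_add_eq_iff_div_mod v.isLt).1 (rfl : (u : ℕ) * n + v = u * n + v)
  simp [cliqueInput, hlt, ← hdiv, hmod]

theorem cliqueEntry_of_ne {w : Fin n → Fin n → ℝ} {M : ℝ} {u v : Fin n} (h : u ≠ v) :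
    cliqueEntry w M u v = w u v := by
  rw [cliqueEntry, if_neg (Fin.val_ne_of_ne h), cliqueInput_entry]

theorem cliqueEntry_self {w : Fin n → Fin n → ℝ} {M : ℝ} (u : ℕ) :
    cliqueEntry w M u u = -M := if_pos rfl

section Gadgets

variable {w : Fin n → Fin n → ℝ} {M : ℝ} {lo hi : ℝ × ℝ} {z : Fin k → Fin n}

theorem boxSum_cellPoints_axisStep (hlo : lo ≤ 0) (hhi : 0 ≤ hi) {a b u v : ℕ} (hu : u < n)
    (hv : v < n) (g : ℝ) :
    boxSum (cellPoints n (n ^ (a / 2)) (n ^ (b / 2)) (axisStep n a) (axisStep n b) u v g) lo hi =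
      if HasDigit n lo.1 hi.1 a u ∧ HasDigit n lo.2 hi.2 b v then g else 0 :=
  boxSum_cellPoints (mul_axisStep_mem_iff hlo.1 hhi.1 (Nat.zero_lt_of_lt hu) a)
    (mul_axisStep_mem_iff hlo.2 hhi.2 (Nat.zero_lt_of_lt hu) b) hu hv

theorem boxSum_vertexPoints (hlo : lo ≤ 0) (hhi : 0 ≤ hi) (b : Fin k) :
    boxSum (vertexPoints n M b) lo hi = ∑ u : Fin n,
      if HasDigit n lo.1 hi.1 b u ∧ HasDigit n lo.2 hi.2 b.rev u then M else 0 := by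
  rw [vertexPoints, boxSum_flatMap_range, Finset.sum_range]
  exact Finset.sum_congr rfl fun u _ => boxSum_cellPoints_axisStep hlo hhi u.isLt u.isLt M

theorem boxSum_edgePoints (hlo : lo ≤ 0) (hhi : 0 ≤ hi) (x : Fin k × Fin k) :
    boxSum (edgePoints w M x) lo hi = ∑ u : Fin n, ∑ v : Fin n,
      if HasDigit n lo.1 hi.1 x.1 u ∧ HasDigit n lo.2 hi.2 x.2.rev v then cliqueEntry w M u v
      else 0 := by
  simp only [edgePoints, boxSum_flatMap_range, Finset.sum_range]
  exact Finset.sum_congr rfl fun u _ => Finset.sum_congr rfl fun v _ =>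
    boxSum_cellPoints_axisStep hlo hhi u.isLt v.isLt _

theorem Encodes.boxSum_vertexPoints (h : Encodes lo hi z) (hlo : lo ≤ 0) (hhi : 0 ≤ hi)
    (b : Fin k) : boxSum (vertexPoints n M b) lo hi = M := by
  simp [_root_.boxSum_vertexPoints hlo hhi, (h b).1.iff_eq, (h b).2.iff_eq, -Fin.val_rev]

theorem Encodes.boxSum_edgePoints (h : Encodes lo hi z) (hlo : lo ≤ 0) (hhi : 0 ≤ hi)
    (x : Fin k × Fin k) :
    boxSum (edgePoints w M x) lo hi = cliqueEntry w M (z x.1) (z x.2) := by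
  simp [_root_.boxSum_edgePoints hlo hhi, (h x.1).1.iff_eq, (h x.2).2.iff_eq, ite_and,
    -Fin.val_rev]

theorem sum_ite_le_of_subsingleton {ι : Type*} [Fintype ι] {p : ι → Prop} [DecidablePred p]
    {f : ι → ℝ} {B : ℝ} (hp : ∀ i j, p i → p j → i = j) (hB : 0 ≤ B) (hf : ∀ i, f i ≤ B) :
    ∑ i, (if p i then f i else 0) ≤ B := by
  by_cases h : ∃ i, p i
  · obtain ⟨i, hi⟩ := h
    rw [Fintype.sum_eq_single i fun j hj => if_neg fun hpj => hj (hp j i hpj hi), if_pos hi]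
    exact hf i
  · simpa [not_exists.1 h] using hB

theorem boxSum_vertexPoints_le (hlo : lo ≤ 0) (hhi : 0 ≤ hi) (hM : 0 ≤ M) (b : Fin k) :
    boxSum (vertexPoints n M b) lo hi ≤ M := by
  rw [boxSum_vertexPoints hlo hhi]
  exact sum_ite_le_of_subsingleton (fun u v hu hv => hv.1.iff_eq.1 hu.1) hM fun _ => le_rfl

theorem boxSum_edgePoints_le {B : ℝ} (hlo : lo ≤ 0) (hhi : 0 ≤ hi) (hB : 0 ≤ B)
    (hentry : ∀ u v : Fin n, cliqueEntry w M u v ≤ B) (x : Fin k × Fin k) :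
    boxSum (edgePoints w M x) lo hi ≤ B := by
  rw [boxSum_edgePoints hlo hhi, ← Fintype.sum_prod_type']
  exact sum_ite_le_of_subsingleton
    (fun u v hu hv => Prod.ext (hv.1.iff_eq.1 hu.1) (hv.2.iff_eq.1 hu.2)) hB
    fun u => hentry u.1 u.2

theorem boxSum_vertexPoints_eq_zero (hlo : lo ≤ 0) (hhi : 0 ≤ hi) {b : Fin k}
    (h : ∀ u : Fin n, HasDigit n lo.1 hi.1 b u → ¬ HasDigit n lo.2 hi.2 b.rev u) :
    boxSum (vertexPoints n M b) lo hi = 0 := by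
  rw [boxSum_vertexPoints hlo hhi]
  exact Finset.sum_eq_zero fun u _ => if_neg fun hu => h u hu.1 hu.2

theorem boxSum_reductionPoints (k : ℕ) (w : Fin n → Fin n → ℝ) (M : ℝ) :
    boxSum (reductionPoints k w M) lo hi =
      (∑ x ∈ digitPairs k, boxSum (edgePoints w M x) lo hi) +
        ∑ b : Fin k, boxSum (vertexPoints n M b) lo hi := by
  rw [reductionPoints, boxSum_append, boxSum_flatMap, boxSum_flatMap, Finset.sum_map_toList,
    Finset.sum_map_toList]

theorem boxSum_reductionPoints_of_injective (hw : ∀ i j, w i j = w j i) (hlo : lo ≤ 0)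
    (hhi : 0 ≤ hi) (z : Fin k ↪ Fin n) (h : Encodes lo hi z) :
    boxSum (reductionPoints k w M) lo hi = k * M + cliqueWeight w (Finset.univ.map z) := by
  have hedge : ∀ x ∈ digitPairs k, boxSum (edgePoints w M x) lo hi = w (z x.1) (z x.2) := by
    intro x hx
    rw [h.boxSum_edgePoints hlo hhi, cliqueEntry_of_ne (z.injective.ne _)]
    exact (Finset.mem_filter.1 hx).2.ne
  rw [boxSum_reductionPoints, Finset.sum_congr rfl hedge, cliqueWeight_map hw, cliqueWeight_univ]
  simp [h.boxSum_vertexPoints hlo hhi, add_comm]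

theorem sum_le_card_mul_sub {ι : Type*} {s : Finset ι} {f : ι → ℝ} {B c : ℝ} {i : ι} (hi : i ∈ s)
    (hf : ∀ j ∈ s, f j ≤ B) (hfi : f i ≤ B - c) : ∑ j ∈ s, f j ≤ s.card * B - c := by
  classical
  have hrest := Finset.sum_le_card_nsmul (s.erase i) f B fun j hj =>
    hf j (Finset.mem_of_mem_erase hj)
  rw [nsmul_eq_mul, Finset.cast_card_erase_of_mem hi] at hrest
  rw [← Finset.add_sum_erase s f hi]
  linarith

theorem exists_digitPairs_of_not_injective (h : ¬ z.Injective) :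
    ∃ x ∈ digitPairs k, z x.1 = z x.2 := by
  obtain ⟨a, b, hab, hne⟩ := Function.not_injective_iff.1 h
  rcases hne.lt_or_gt with hlt | hlt
  · exact ⟨(a, b), by simpa [digitPairs], hab⟩
  · exact ⟨(b, a), by simpa [digitPairs], hab.symm⟩

theorem card_digitPairs_le (k : ℕ) : (digitPairs k).card ≤ k ^ 2 := by
  simpa [sq] using Finset.card_le_univ (digitPairs k)

/-- A box that encodes no sequence of vertices misses the reward of a vertex gadget, and one that
encodes a sequence with a repetition suffers the penalty of an edge gadget. -/
theorem exists_encodes_or_boxSum_reductionPoints_le {B : ℝ} (hw : ∀ i j, w i j ≤ B) (hB : 0 ≤ B)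
    (hM : 0 ≤ M) (hlo : lo ≤ 0) (hhi : 0 ≤ hi) :
    (∃ z : Fin k ↪ Fin n, Encodes lo hi z) ∨
      boxSum (reductionPoints k w M) lo hi ≤ k * M + (k ^ 2 * B - M) := by
  have hcard : (digitPairs k).card * B ≤ k ^ 2 * B :=
    mul_le_mul_of_nonneg_right (by exact_mod_cast card_digitPairs_le k) hB
  have hentry (u v : Fin n) : cliqueEntry w M u v ≤ B := by
    rcases eq_or_ne u v with rfl | huv
    · rw [cliqueEntry_self]
      linarith
    · exact cliqueEntry_of_ne huv ▸ hw u v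
  have hedge (x : Fin k × Fin k) := boxSum_edgePoints_le hlo hhi hB hentry x
  have hvertex (b : Fin k) := boxSum_vertexPoints_le (n := n) hlo hhi hM b
  rw [boxSum_reductionPoints]
  by_cases hdigit : ∀ b : Fin k, ∃ u : Fin n,
      HasDigit n lo.1 hi.1 b u ∧ HasDigit n lo.2 hi.2 b.rev u
  · choose z hz using hdigit
    by_cases hinj : z.Injective
    · exact .inl ⟨⟨z, hinj⟩, hz⟩
    right
    obtain ⟨x, hx, hrep⟩ := exists_digitPairs_of_not_injective hinj
    have hpenalty : boxSum (edgePoints w M x) lo hi ≤ B - M := by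
      rw [Encodes.boxSum_edgePoints hz hlo hhi, hrep, cliqueEntry_self]
      linarith
    have hedges := sum_le_card_mul_sub hx (fun x _ => hedge x) hpenalty
    have hvertices := Finset.sum_le_card_nsmul Finset.univ _ M fun b _ => hvertex b
    rw [nsmul_eq_mul, Finset.card_fin] at hvertices
    linarith
  · right
    push Not at hdigit
    obtain ⟨b, hb⟩ := hdigit
    have hvertices := sum_le_card_mul_sub (c := M) (Finset.mem_univ b) (fun b _ => hvertex b)
      (by rw [boxSum_vertexPoints_eq_zero hlo hhi hb, sub_self])
    have hedges := Finset.sum_le_card_nsmul (digitPairs k) _ B fun x _ => hedge x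
    rw [Finset.card_fin] at hvertices
    rw [nsmul_eq_mul] at hedges
    linarith

theorem weight_le_of_mem_cellPoints {A B u v : ℕ} {X Y g : ℝ} {p : WeightedPoint}
    (hp : p ∈ cellPoints n A B X Y u v g) : p.2 ≤ |g| := by
  simp only [cellPoints, quad, List.mem_flatMap, List.mem_cons, List.not_mem_nil, or_false] at hp
  obtain ⟨α, -, β, -, rfl | rfl | rfl | rfl⟩ := hp <;>
    first | exact le_abs_self g | exact neg_le_abs g

theorem weight_le_of_mem_reductionPoints (hw : ∀ i j, |w i j| ≤ M) (hM : 0 ≤ M) :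
    ∀ p ∈ reductionPoints k w M, p.2 ≤ M := by
  have hentry (u v : Fin n) : |cliqueEntry w M u v| ≤ M := by
    rcases eq_or_ne u v with rfl | huv
    · rw [cliqueEntry_self, abs_neg, abs_of_nonneg hM]
    · exact cliqueEntry_of_ne huv ▸ hw u v
  intro p hp
  simp only [reductionPoints, edgePoints, vertexPoints, List.mem_append, List.mem_flatMap,
    List.mem_range] at hp
  obtain ⟨x, -, u, hu, v, hv, hp⟩ | ⟨b, -, u, -, hp⟩ := hp
  · exact (weight_le_of_mem_cellPoints hp).trans (hentry ⟨u, hu⟩ ⟨v, hv⟩)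
  · exact (weight_le_of_mem_cellPoints hp).trans_eq (abs_of_nonneg hM)

theorem neg_mul_le_cliqueWeight {B : ℝ} (hw : ∀ i j, w i j = w j i) (hB : ∀ i j, -B ≤ w i j)
    (hB₀ : 0 ≤ B) {S : Finset (Fin n)} (hS : S.card = k) : -(k ^ 2 * B) ≤ cliqueWeight w S := by
  obtain ⟨z, rfl⟩ := exists_map_univ_eq hS
  have hsum := Finset.card_nsmul_le_sum (digitPairs k) (fun x => w (z x.1) (z x.2)) (-B)
    fun x _ => hB _ _
  rw [cliqueWeight_map hw, cliqueWeight_univ]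
  rw [nsmul_eq_mul] at hsum
  have hcard : ((digitPairs k).card : ℝ) ≤ k ^ 2 := by exact_mod_cast card_digitPairs_le k
  nlinarith

end Gadgets

/-- The instance of Max-Weight Rectangle to which a weighted graph is reduced. The point at the
origin outweighs all others, so that a box of maximum weight contains it. -/
noncomputable def reductionInstance (k : ℕ) (w : Fin n → Fin n → ℝ) (M : ℝ) :
    List WeightedPoint :=
  reductionPoints k w M ++ [(((0 : ℝ), (0 : ℝ)), (reductionPoints k w M).length * M)]

/-- The part of the weight of an optimal box that does not come from the edges of a clique. -/
noncomputable def reductionOffset (k : ℕ) (w : Fin n → Fin n → ℝ) (M : ℝ) : ℝ :=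
  (reductionPoints k w M).length * M + k * M

/-- A bound for all edge weights that can be computed without taking absolute values. -/
def weightBound (w : Fin n → Fin n → ℝ) : ℝ := ∑ u, ∑ v, (w u v ^ 2 + 1)

/-- The reward and penalty used by the reduction. -/
def penalty (k : ℕ) (w : Fin n → Fin n → ℝ) : ℝ := 2 * k ^ 2 * weightBound w + 1

theorem abs_le_weightBound (w : Fin n → Fin n → ℝ) (u v : Fin n) : |w u v| ≤ weightBound w := by
  have hterm (u v : Fin n) : 0 ≤ w u v ^ 2 + 1 := by positivity
  calc |w u v| ≤ w u v ^ 2 + 1 := by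
        rw [abs_le]
        constructor <;> nlinarith [sq_nonneg (w u v - 1), sq_nonneg (w u v + 1)]
    _ ≤ ∑ v, (w u v ^ 2 + 1) :=
        Finset.single_le_sum (f := fun v => w u v ^ 2 + 1) (fun v _ => hterm u v)
          (Finset.mem_univ v)
    _ ≤ weightBound w :=
        Finset.single_le_sum (f := fun u => ∑ v, (w u v ^ 2 + 1))
          (fun u _ => Finset.sum_nonneg fun v _ => hterm u v) (Finset.mem_univ u)

theorem weightBound_nonneg (w : Fin n → Fin n → ℝ) : 0 ≤ weightBound w :=
  Finset.sum_nonneg fun _ _ => Finset.sum_nonneg fun _ _ => by positivity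

section Instance

variable {w : Fin n → Fin n → ℝ} {M B : ℝ}

theorem exists_boxSum_reductionInstance_eq (hw : ∀ i j, w i j = w j i) (M : ℝ)
    {S : Finset (Fin n)} (hS : S.card = k) : ∃ lo hi : ℝ × ℝ, lo ≤ hi ∧
      boxSum (reductionInstance k w M) lo hi = reductionOffset k w M + cliqueWeight w S := by
  obtain ⟨z, rfl⟩ := exists_map_univ_eq hS
  obtain ⟨lo, hi, hlo, hhi, hz⟩ := exists_encodes z
  refine ⟨lo, hi, hlo.trans hhi, ?_⟩
  have horigin : ((0 : ℝ), (0 : ℝ)) ∈ Set.Icc lo hi := ⟨hlo, hhi⟩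
  rw [reductionInstance, boxSum_append, boxSum_reductionPoints_of_injective hw hlo hhi z hz,
    boxSum_singleton, if_pos horigin, reductionOffset]
  ring

theorem exists_boxSum_reductionInstance_eq_or_le (hk : 0 < k) (hw : ∀ i j, w i j = w j i)
    (hB : ∀ i j, |w i j| ≤ B) (hB₀ : 0 ≤ B) (hBM : B ≤ M) (lo hi : ℝ × ℝ) :
    (∃ S : Finset (Fin n), S.card = k ∧
      boxSum (reductionInstance k w M) lo hi = reductionOffset k w M + cliqueWeight w S) ∨
    boxSum (reductionInstance k w M) lo hi ≤ reductionOffset k w M + (k ^ 2 * B - M) := by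
  have hM : 0 ≤ M := hB₀.trans hBM
  rw [reductionInstance, boxSum_append, boxSum_singleton, reductionOffset]
  by_cases horigin : ((0 : ℝ), (0 : ℝ)) ∈ Set.Icc lo hi
  · rw [if_pos horigin]
    obtain ⟨hlo, hhi⟩ := horigin
    rcases exists_encodes_or_boxSum_reductionPoints_le (k := k)
      (fun i j => le_of_abs_le (hB i j)) hB₀ hM hlo hhi with ⟨z, hz⟩ | hle
    · refine .inl ⟨Finset.univ.map z, by simp, ?_⟩
      rw [boxSum_reductionPoints_of_injective hw hlo hhi z hz]
      ring
    · right
      linarith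
  · right
    have hle := boxSum_le (lo := lo) (hi := hi) hM
      (weight_le_of_mem_reductionPoints (k := k) (fun i j => (hB i j).trans hBM) hM)
    have hkM : M ≤ k * M := le_mul_of_one_le_left hM (by exact_mod_cast hk)
    have hkB : 0 ≤ k ^ 2 * B := by positivity
    rw [if_neg horigin]
    linarith

theorem isGreatest_of_isMaxWeightBox (hk : 0 < k) (hkn : k ≤ n) (hw : ∀ i j, w i j = w j i)
    (hM : penalty k w = M) {lo hi : ℝ × ℝ}
    (hmax : IsMaxWeightBox (fun i : Fin (reductionInstance k w M).length =>
      (reductionInstance k w M)[i].1) (fun i => (reductionInstance k w M)[i].2) lo hi) :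
    IsGreatest (cliqueWeight w '' {S | (⊤ : SimpleGraph (Fin n)).IsNClique k S})
      (boxSum (reductionInstance k w M) lo hi - reductionOffset k w M) := by
  have hB := abs_le_weightBound w
  have hB₀ := weightBound_nonneg w
  have hk' : (1 : ℝ) ≤ k ^ 2 := one_le_pow₀ (by exact_mod_cast hk)
  have hM' : M = 2 * k ^ 2 * weightBound w + 1 := by rw [← hM, penalty]
  have hBM : weightBound w ≤ M := by nlinarith
  have hupper {S : Finset (Fin n)} (hS : S.card = k) :
      cliqueWeight w S ≤ boxSum (reductionInstance k w M) lo hi - reductionOffset k w M := by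
    obtain ⟨lo', hi', hle, heq⟩ := exists_boxSum_reductionInstance_eq hw M hS
    have hopt := hmax.2 lo' hi' hle
    rw [boxWeight_eq_boxSum, boxWeight_eq_boxSum] at hopt
    linarith
  simp only [isNClique_top_iff]
  refine ⟨?_, Set.forall_mem_image.2 fun S hS => hupper hS⟩
  rcases exists_boxSum_reductionInstance_eq_or_le hk hw hB hB₀ hBM lo hi with ⟨S, hS, heq⟩ | hle
  · exact ⟨S, hS, by linarith⟩
  · obtain ⟨S, -, hS⟩ := Finset.exists_subset_card_eq (s := (Finset.univ : Finset (Fin n)))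
      (by simpa using hkn)
    have hlower := neg_mul_le_cliqueWeight hw (fun i j => neg_le_of_abs_le (hB i j)) hB₀ hS
    linarith [hupper hS]

end Instance

end Reduction

/-! ### Programming the reduction -/

namespace RealRAM

/-- The memory as the gadgets need it: the order `n` of the graph and the constants `1`, `0` and
`M` in registers, and the graph itself in the real array `0`. -/
structure Ready {n : ℕ} (w : Fin n → Fin n → ℝ) (M : ℝ) (s : State) : Prop where
  order : s.ireg 0 = n
  one : s.ireg 2 = 1
  zero : s.rreg 0 = 0
  reward : s.rreg 2 = M
  graph : s.rarr 0 = (cliqueInput w).rarr 0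

/-- The grid of a gadget with digit `a` on the `x`-axis and digit `b` on the `y`-axis is described
by the registers `3` and `4` of either kind. -/
structure Grid (n a b : ℕ) (s : State) : Prop where
  columns : s.ireg 3 = n ^ (a / 2)
  rows : s.ireg 4 = n ^ (b / 2)
  width : s.rreg 3 = axisStep n a
  height : s.rreg 4 = axisStep n b

/-- Write down the quad of weight `rreg 9` at the grid point that is given by the digits in the
index registers `5` and `7`, the multiples of `n` in `11` and `13`, and the steps in the real
registers `3` and `4`. -/
def quadProg : Prog :=
  .seq (.block [.iadd 14 11 5, .rcast 14 14, .rmul 14 14 3, .radd 15 14 3, .iadd 14 13 7,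
      .rcast 16 14, .rmul 16 16 4, .radd 17 16 4, .rsub 18 0 9])
    (.seq (emitProg 14 16 9) (.seq (emitProg 15 16 18)
      (.seq (emitProg 14 17 18) (emitProg 15 17 9))))

/-- Write down the points of one cell of a gadget, as in `cellPoints`. -/
def cellProg : Prog := .forRange 10 3 (.forRange 12 4 quadProg)

/-- Write down a vertex gadget, as in `vertexPoints`. -/
def vertexProg : Prog :=
  .forRange 5 0 (.seq (.block [.isub 8 0 0, .iadd 7 5 8, .radd 9 2 0]) cellProg)

/-- Load `cliqueEntry w M u v` into the real register `9`, with `u`, `u * n` and `v` in the index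
registers `5`, `6` and `7`. -/
def entryProg : Prog :=
  .seq (.block [.iadd 9 6 7, .rload 9 0 9])
    (.branch (.ilt 5 7) .skip (.branch (.ilt 7 5) .skip (.instr (.rsub 9 0 2))))

/-- Write down an edge gadget, as in `edgePoints`. -/
def edgeProg : Prog := .forRange 5 0 (.forRange 7 0 (.seq entryProg cellProg))

/-- Set up the grid with digit `a` on the `x`-axis and digit `b` on the `y`-axis. -/
def gridProg (a b : ℕ) : Prog :=
  .seq (powProg 3 (a / 2)) (.seq (powProg 4 (b / 2))
    (.block [.rcast 5 0, .rcast 3 3, .rmul 3 3 5, .rconst 6 (axisSign a), .rdiv 3 6 3,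
      .rcast 4 4, .rmul 4 4 5, .rconst 6 (axisSign b), .rdiv 4 6 4]))

/-- Write down the points of the reduction, as in `reductionPoints`. -/
noncomputable def reductionProg (k : ℕ) : Prog :=
  .seq (.seqs ((digitPairs k).toList.map fun x => .seq (gridProg x.1 x.2.rev) edgeProg))
    (.seqs ((Finset.univ : Finset (Fin k)).toList.map fun b : Fin k =>
      .seq (gridProg b b.rev) vertexProg))

section Gadgets

variable {n k a b c : ℕ} {w : Fin n → Fin n → ℝ} {M : ℝ} {s s' : State}

theorem Ready.of_frame (h : Ready w M s) (hs : Frame c s s') (hc : 2 < c) : Ready w M s' where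
  order := (hs.ireg 0 (by lia) (by lia)).trans h.order
  one := (hs.ireg 2 hc (by lia)).trans h.one
  zero := (hs.rreg 0 (by lia)).trans h.zero
  reward := (hs.rreg 2 hc).trans h.reward
  graph := hs.graph.trans h.graph

theorem Grid.of_frame (h : Grid n a b s) (hs : Frame c s s') (hc : 4 < c) : Grid n a b s' where
  columns := (hs.ireg 3 (by lia) (by lia)).trans h.columns
  rows := (hs.ireg 4 hc (by lia)).trans h.rows
  width := (hs.rreg 3 (by lia)).trans h.width
  height := (hs.rreg 4 hc).trans h.height

theorem runs_quadProg (h : Ready w M s) :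
    Runs quadProg s 46 (Appends 14 (quad (((s.ireg 11 + s.ireg 5 : ℕ) : ℝ) * s.rreg 3) (s.rreg 3)
      (((s.ireg 13 + s.ireg 7 : ℕ) : ℝ) * s.rreg 4) (s.rreg 4) (s.rreg 9)) s) := by
  set x : ℝ := ((s.ireg 11 + s.ireg 5 : ℕ) : ℝ) * s.rreg 3 with hx
  set y : ℝ := ((s.ireg 13 + s.ireg 7 : ℕ) : ℝ) * s.rreg 4 with hy
  refine (Runs.seq (T₂ := 36) (R := fun s' => ScratchEq 14 s s' ∧ s'.rreg 14 = x ∧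
    s'.rreg 15 = x + s.rreg 3 ∧ s'.rreg 16 = y ∧ s'.rreg 17 = y + s.rreg 4 ∧
    s'.rreg 18 = -s.rreg 9) (.block ⟨.foldl_apply (by simp [Instr.IsScratch]), ?_⟩) ?_).mono le_rfl
    fun _ => id
  · simp [Instr.apply, hx, hy, h.zero]
  rintro s' ⟨hs', h14, h15, h16, h17, h18⟩
  have hready : Ready w M s' := h.of_frame (hs'.appends_nil (by lia)).toFrame (by lia)
  have hg : s'.rreg 9 = s.rreg 9 := hs'.rreg 9 (by lia)
  have hemit {s'' : State} (hs'' : Frame 19 s' s'') (i j g : ℕ) (hi : i < 19) (hj : j < 19)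
      (hg : g < 19) : Runs (emitProg i j g) s'' 9
        (Appends 19 [((s'.rreg i, s'.rreg j), s'.rreg g)] s'') := by
    rw [← hs''.rreg i hi, ← hs''.rreg j hj, ← hs''.rreg g hg]
    exact runs_emitProg (by lia) (hready.of_frame hs'' (by lia)).one
  refine (Runs.append (hemit (ScratchEq.refl.appends_nil (by lia)).toFrame 14 16 9 (by lia)
    (by lia) (by lia)) fun s₁ h₁ => .append (hemit h₁ 15 16 18 (by lia) (by lia) (by lia))
    fun s₂ h₂ => .append (hemit (h₁.trans h₂) 14 17 18 (by lia) (by lia) (by lia))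
    fun s₃ h₃ => hemit ((h₁.trans h₂).trans h₃) 15 17 9 (by lia) (by lia) (by lia)).mono le_rfl
    fun s'' hs'' => ?_
  rw [h14, h15, h16, h17, h18, hg] at hs''
  exact (hs'.appends_nil (by lia)).trans (hs''.mono (by lia))

theorem runs_cellProg (h : Ready w M s) (hgrid : Grid n a b s) (hn : 0 < n) :
    Runs cellProg s (62 * (n ^ (a / 2) * n ^ (b / 2))) (Appends 10 (cellPoints n (n ^ (a / 2))
      (n ^ (b / 2)) (axisStep n a) (axisStep n b) (s.ireg 5) (s.ireg 7) (s.rreg 9)) s) := by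
  refine (Runs.flatMapRange (n := n) (T := n ^ (b / 2) * (46 + 4) + 4) (by lia) (by lia) (by lia)
    (by lia) hgrid.columns h.order h.one fun α _ s₁ h₁ _ hα' =>
    .flatMapRange (n := n) (by lia) (by lia) (by lia) (by lia)
      (hgrid.of_frame h₁ (by lia)).rows (h.of_frame h₁ (by lia)).order
      (h.of_frame h₁ (by lia)).one fun β _ s₂ h₂ _ hβ' => ?_).mono ?_ fun _ => id
  · have hframe := h₁.trans (h₂.mono (by lia))
    have hgrid' := hgrid.of_frame hframe (by lia)
    have hquad := runs_quadProg (h.of_frame hframe (by lia))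
    rwa [hβ', h₂.ireg 11 (by lia) (by lia), hα', hframe.ireg 5 (by lia) (by lia),
      hframe.ireg 7 (by lia) (by lia), hframe.rreg 9 (by lia), hgrid'.width, hgrid'.height] at hquad
  · have hA : 0 < n ^ (a / 2) := by positivity
    have hB : 0 < n ^ (b / 2) := by positivity
    nlinarith

theorem runs_vertexProg {b : Fin k} (h : Ready w M s) (hgrid : Grid n b b.rev s) (hn : 0 < n) :
    Runs vertexProg s (74 * (n * (n ^ (b / 2 : ℕ) * n ^ (b.rev / 2 : ℕ))))
      (Appends 5 (vertexPoints n M b) s) := by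
  refine (Runs.flatMapRange (n := n) (T := 4 + 62 * (n ^ (b / 2 : ℕ) * n ^ (b.rev / 2 : ℕ)))
    (by lia) (by lia) (by lia) (by lia) h.order h.order h.one fun u _ s₁ h₁ hu' _ => ?_).mono
    ?_ fun _ => id
  · have hready := h.of_frame h₁ (by lia)
    refine Runs.seq (R := fun s₂ => ScratchEq 7 s₁ s₂ ∧ s₂.ireg 7 = u ∧ s₂.rreg 9 = M)
      (.block ⟨.foldl_apply (by simp [Instr.IsScratch]), ?_⟩) ?_
    · simp [Instr.apply, hu', hready.reward, hready.zero]
    rintro s₂ ⟨h₂, hv, hg⟩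
    have hnil := h₂.appends_nil (by lia)
    have hframe := h₁.trans (hnil.toFrame.mono (by lia))
    have hcell := runs_cellProg (h.of_frame hframe (by lia)) (hgrid.of_frame hframe (by lia)) hn
    rw [hv, hg, h₂.ireg 5 (by lia), hu'] at hcell
    exact hcell.mono le_rfl fun _ hs => hnil.trans (hs.mono (by lia))
  · have hle : n ≤ n * (n ^ (b / 2 : ℕ) * n ^ (b.rev / 2 : ℕ)) :=
      Nat.le_mul_of_pos_right n (by positivity)
    lia

theorem runs_entryProg {u v : ℕ} (h : Ready w M s) (hu : s.ireg 5 = u) (hun : s.ireg 6 = u * n)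
    (hv : s.ireg 7 = v) : Runs entryProg s 6 fun s' =>
      ScratchEq 9 s s' ∧ s'.rreg 9 = cliqueEntry w M u v := by
  refine Runs.seq (T₂ := 3) (R := fun s' => ScratchEq 9 s s' ∧
    s'.rreg 9 = (cliqueInput w).rarr 0 (u * n + v))
    (.block ⟨.foldl_apply (by simp [Instr.IsScratch]), ?_⟩) ?_
  · simp [Instr.apply, hun, hv, h.graph]
  rintro s₁ ⟨h₁, hentry⟩
  have hu₁ : s₁.ireg 5 = u := (h₁.ireg 5 (by lia)).trans hu
  have hv₁ : s₁.ireg 7 = v := (h₁.ireg 7 (by lia)).trans hv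
  refine .guard (T := 2) (by lia) (fun hlt => ⟨h₁, ?_⟩) fun hge =>
    .guard (T := 1) (by lia) (fun hgt => ⟨h₁, ?_⟩) fun hle => ?_
  · have hne : u ≠ v := by simpa [Test.Holds, hu₁, hv₁] using hlt.ne
    rw [hentry, cliqueEntry, if_neg hne]
  · have hne : u ≠ v := by simpa [Test.Holds, hu₁, hv₁] using hgt.ne'
    rw [hentry, cliqueEntry, if_neg hne]
  · obtain rfl : u = v := by
      simp only [Test.Holds, hu₁, hv₁] at hge hle
      lia
    refine .instr ⟨h₁.trans (.apply (by simp [Instr.IsScratch])), ?_⟩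
    simp [Instr.apply, cliqueEntry, h₁.rreg, h.zero, h.reward]

theorem runs_edgeProg {x : Fin k × Fin k} (h : Ready w M s) (hgrid : Grid n x.1 x.2.rev s)
    (hn : 0 < n) :
    Runs edgeProg s (84 * (n * (n * (n ^ (x.1 / 2 : ℕ) * n ^ (x.2.rev / 2 : ℕ)))))
      (Appends 5 (edgePoints w M x) s) := by
  refine (Runs.flatMapRange (n := n)
    (T := n * (6 + 62 * (n ^ (x.1 / 2 : ℕ) * n ^ (x.2.rev / 2 : ℕ)) + 4) + 4)
    (by lia) (by lia) (by lia) (by lia) h.order h.order h.one fun u _ s₁ h₁ hu' hun =>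
    .flatMapRange (n := n) (by lia) (by lia) (by lia) (by lia) (h.of_frame h₁ (by lia)).order
      (h.of_frame h₁ (by lia)).order (h.of_frame h₁ (by lia)).one fun v _ s₂ h₂ hv' _ => ?_).mono
    ?_ fun _ => id
  · have hframe₂ := h₁.trans (h₂.mono (by lia))
    have hu₂ : s₂.ireg 5 = u := (h₂.ireg 5 (by lia) (by lia)).trans hu'
    refine (runs_entryProg (h.of_frame hframe₂ (by lia)) hu₂
      ((h₂.ireg 6 (by lia) (by lia)).trans hun) hv').seq ?_
    rintro s₃ ⟨h₃, hentry⟩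
    have hnil := h₃.appends_nil (by lia)
    have hframe := hframe₂.trans (hnil.toFrame.mono (by lia))
    have hcell := runs_cellProg (h.of_frame hframe (by lia)) (hgrid.of_frame hframe (by lia)) hn
    rw [hentry, h₃.ireg 5 (by lia), h₃.ireg 7 (by lia), hu₂, hv'] at hcell
    exact hcell.mono le_rfl fun _ hs => hnil.trans (hs.mono (by lia))
  · have hle : n ≤ n * (n ^ (x.1 / 2 : ℕ) * n ^ (x.2.rev / 2 : ℕ)) :=
      Nat.le_mul_of_pos_right n (by positivity)
    nlinarith

theorem runs_gridProg (h : Ready w M s) (hn : 0 < n) (a b : ℕ) :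
    Runs (gridProg a b) s
      ((13 * (a / 2) + 2) * n ^ (a / 2) + ((13 * (b / 2) + 2) * n ^ (b / 2) + 10)) fun s' =>
      ScratchEq 3 s s' ∧ Grid n a b s' := by
  refine (runs_powProg (by lia) (by lia) h.order hn h.one).seq fun s₁ h₁ =>
    (runs_powProg (by lia) (by lia) ((h₁.1.ireg 0 (by lia)).trans h.order) hn
      ((h₁.1.ireg 2 (by lia)).trans h.one)).seq fun s₂ h₂ => .block ⟨?_, ?_⟩
  · exact h₁.1.trans ((h₂.1.mono (by lia)).trans (.foldl_apply (by simp [Instr.IsScratch])))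
  · have hcols : s₂.ireg 3 = n ^ (a / 2) := (h₂.1.ireg 3 (by lia)).trans h₁.2
    have horder : s₂.ireg 0 = n :=
      (h₂.1.ireg 0 (by lia)).trans ((h₁.1.ireg 0 (by lia)).trans h.order)
    constructor <;> simp [Instr.apply, axisStep, hcols, h₂.2, horder]

theorem Runs.gadget {p : Prog} {T : ℕ} {l : List WeightedPoint} (h : Ready w M s) (hn : 0 < n)
    (ha : a < k) (hb : b < k) (hT : T ≤ 84 * n ^ (k / 2 + 1))
    (hp : ∀ s', Ready w M s' → Grid n a b s' → Runs p s' T (Appends 5 l s')) :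
    Runs (.seq (gridProg a b) p) s ((13 * k + 98) * n ^ (k / 2 + 1)) (Appends 3 l s) := by
  have hpow {e : ℕ} (he : e < k) :
      (13 * (e / 2) + 2) * n ^ (e / 2) ≤ (13 * (k / 2) + 2) * n ^ (k / 2 + 1) := by
    gcongr
    lia
  refine ((runs_gridProg h hn a b).seq (T₂ := T) fun s₁ h₁ => ?_).mono ?_ fun _ => id
  · have hnil := h₁.1.appends_nil (by lia)
    exact (hp s₁ (h.of_frame hnil.toFrame (by lia)) h₁.2).mono le_rfl fun _ hs =>
      hnil.trans (hs.mono (by lia))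
  · have hk : 2 * (k / 2) ≤ k := Nat.mul_div_le k 2
    have hpos : 0 < n ^ (k / 2 + 1) := by positivity
    nlinarith [hpow ha, hpow hb]

end Gadgets

end RealRAM

/-- The number of points of the reduction, apart from the heavy one. -/
def numPoints (k n : ℕ) : ℕ :=
  ∑ x ∈ digitPairs k, n * (n * (n ^ (x.1 / 2 : ℕ) * n ^ (x.2.rev / 2 : ℕ) * 4)) +
    ∑ b : Fin k, n * (n ^ (b / 2 : ℕ) * n ^ (b.rev / 2 : ℕ) * 4)

section Size

variable {n k : ℕ}

theorem edge_size_le {x : Fin k × Fin k} (hx : x ∈ digitPairs k) (hn : 0 < n) :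
    n * (n * (n ^ (x.1 / 2 : ℕ) * n ^ (x.2.rev / 2 : ℕ))) ≤ n ^ (k / 2 + 1) := by
  have hlt : (x.1 : ℕ) < x.2 := (Finset.mem_filter.1 hx).2
  rw [← pow_add, ← pow_succ', ← pow_succ']
  refine Nat.pow_le_pow_right hn ?_
  rw [Fin.val_rev]
  lia

theorem vertex_size_le (b : Fin k) (hn : 0 < n) :
    n * (n ^ (b / 2 : ℕ) * n ^ (b.rev / 2 : ℕ)) ≤ n ^ (k / 2 + 1) := by
  rw [← pow_add, ← pow_succ']
  refine Nat.pow_le_pow_right hn ?_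
  rw [Fin.val_rev]
  lia

theorem length_cellPoints (n A B : ℕ) (X Y : ℝ) (u v : ℕ) (g : ℝ) :
    (cellPoints n A B X Y u v g).length = A * B * 4 := by
  simp [cellPoints, quad, mul_assoc]

theorem length_reductionPoints (w : Fin n → Fin n → ℝ) (M : ℝ) :
    (reductionPoints k w M).length = numPoints k n := by
  simp [reductionPoints, edgePoints, vertexPoints, length_cellPoints, numPoints,
    Finset.sum_map_toList]

theorem length_reductionInstance (w : Fin n → Fin n → ℝ) (M : ℝ) :
    (reductionInstance k w M).length = numPoints k n + 1 := by
  rw [reductionInstance, List.length_append, length_reductionPoints, List.length_singleton]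

theorem numPoints_le (hn : 0 < n) : numPoints k n ≤ 4 * (k ^ 2 + k) * n ^ (k / 2 + 1) := by
  have hedges := Finset.sum_le_card_nsmul (digitPairs k)
    (fun x => n * (n * (n ^ (x.1 / 2 : ℕ) * n ^ (x.2.rev / 2 : ℕ) * 4))) (4 * n ^ (k / 2 + 1))
    fun x hx => by linarith [edge_size_le hx hn]
  have hvertices := Finset.sum_le_card_nsmul Finset.univ
    (fun b : Fin k => n * (n ^ (b / 2 : ℕ) * n ^ (b.rev / 2 : ℕ) * 4)) (4 * n ^ (k / 2 + 1))
    fun b _ => by linarith [vertex_size_le b hn]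
  have hcard := card_digitPairs_le k
  rw [Finset.card_univ, Fintype.card_fin, smul_eq_mul] at hvertices
  rw [numPoints]
  calc _ ≤ (digitPairs k).card * (4 * n ^ (k / 2 + 1)) + k * (4 * n ^ (k / 2 + 1)) :=
        add_le_add hedges hvertices
    _ ≤ k ^ 2 * (4 * n ^ (k / 2 + 1)) + k * (4 * n ^ (k / 2 + 1)) := by gcongr
    _ = _ := by ring

end Size

namespace RealRAM

variable {n k : ℕ} {w : Fin n → Fin n → ℝ} {M : ℝ} {s : State}

theorem runs_reductionProg (h : Ready w M s) (hn : 0 < n) :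
    Runs (reductionProg k) s ((k ^ 2 + k) * (13 * k + 98) * n ^ (k / 2 + 1) + 2)
      (Appends 3 (reductionPoints k w M) s) := by
  refine (Runs.append (Runs.flatMapSeqs (T := (13 * k + 98) * n ^ (k / 2 + 1))
    (fun x hx s₁ h₁ => ?_) (by lia)) fun s₁ h₁ => Runs.flatMapSeqs
    (T := (13 * k + 98) * n ^ (k / 2 + 1)) (fun b _ s₂ h₂ => ?_) (by lia)).mono ?_ fun _ => id
  · exact .gadget (h.of_frame h₁ (by lia)) hn x.1.2 x.2.rev.2
      (Nat.mul_le_mul_left _ (edge_size_le (Finset.mem_toList.1 hx) hn))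
      fun _ hready hgrid => runs_edgeProg hready hgrid hn
  · exact .gadget (h.of_frame (h₁.trans h₂) (by lia)) hn b.2 b.rev.2
      ((Nat.mul_le_mul_left _ (vertex_size_le b hn)).trans (by lia))
      fun _ hready hgrid => runs_vertexProg hready hgrid hn
  · have hcard := Nat.mul_le_mul_right ((13 * k + 98) * n ^ (k / 2 + 1))
      (card_digitPairs_le k)
    rw [Finset.length_toList, Finset.length_toList, Finset.card_univ, Fintype.card_fin]
    linarith

/-- Add `weightBound w` to the real register `9`. -/
def weightBoundProg : Prog :=
  .forRange 3 0 (.forRange 5 0 (.block [.iadd 7 4 5, .rload 7 0 7, .rmul 7 7 7, .rconst 8 1,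
    .radd 7 7 8, .radd 9 9 7]))

/-- Set up the constants of `Ready`, with `penalty k w` for `M`. -/
def initProg (k : ℕ) : Prog :=
  .seq (.block [.iconst 2 1, .rconst 9 0])
    (.seq weightBoundProg (.block [.rconst 7 (2 * k ^ 2), .rmul 7 7 9, .rconst 8 1,
      .radd 2 7 8]))

/-- Write down the heavy point and leave `reductionOffset` in the real register `4`. -/
def heavyProg (k : ℕ) : Prog :=
  .seq (.block [.rcast 3 1, .rmul 3 3 2, .rconst 4 k, .rmul 4 4 2, .radd 4 3 4])
    (emitProg 0 0 3)

/-- Add the weight of the point whose number is in the index register `5` to the real register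
`9` if the point is in the box with corners in the real registers `40` to `43`. These are the output
registers of the relocated rectangle algorithm. -/
def scanStep : Prog :=
  .seq (.block [.rload 10 1 5, .rload 11 2 5, .rload 12 3 5])
    (.branch (.rlt 10 40) .skip (.branch (.rlt 11 41) .skip (.branch (.rlt 42 10) .skip
      (.branch (.rlt 43 11) .skip (.instr (.radd 9 9 12))))))

/-- Subtract the real register `4` from the weight of the box found by the rectangle algorithm. -/
def scanProg : Prog :=
  .seq (.block [.rconst 9 0]) (.seq (.forRange 5 1 scanStep) (.instr (.rsub 0 9 4)))

/-- The algorithm for Max-Weight Clique that calls the rectangle algorithm `P`. -/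
noncomputable def cliqueProg (k : ℕ) (P : Prog) : Prog :=
  .seq (initProg k) (.seq (reductionProg k) (.seq (heavyProg k) (.seq (P.shift 40) scanProg)))

theorem pointBuffer_cliqueInput (w : Fin n → Fin n → ℝ) : PointBuffer [] (cliqueInput w) := by
  constructor <;> simp [cliqueInput, listInput, rectangleInput, State.high]

theorem runs_weightBoundProg (hn : s.ireg 0 = n) (hone : s.ireg 2 = 1)
    (hgraph : s.rarr 0 = (cliqueInput w).rarr 0) :
    Runs weightBoundProg s (n * (n * (7 + 4) + 4 + 4) + 4) fun s' =>
      ScratchEq 3 s s' ∧ s'.rreg 9 = s.rreg 9 + weightBound w := by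
  let square (u v : ℕ) : ℝ := (cliqueInput w).rarr 0 (u * n + v) ^ 2 + 1
  have hsum : weightBound w = ∑ u ∈ Finset.range n, ∑ v ∈ Finset.range n, square u v := by
    simp only [Finset.sum_range, weightBound, square, cliqueInput_entry]
  rw [hsum]
  refine .sumRange (by lia) (by lia) (by lia) hn hn hone fun u _ s₁ h₁ _ hun => ?_
  have hn₁ : s₁.ireg 0 = n := (h₁.ireg 0 (by lia)).trans hn
  refine .sumRange (by lia) (by lia) (by lia) hn₁ hn₁ ((h₁.ireg 2 (by lia)).trans hone)
    fun v _ s₂ h₂ hv' _ => .block ⟨.foldl_apply (by simp [Instr.IsScratch]), ?_⟩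
  have hun₂ : s₂.ireg 4 = u * n := (h₂.ireg 4 (by lia)).trans hun
  simp [Instr.apply, hun₂, hv', h₂.rarr, h₁.rarr, hgraph, square, sq]

theorem runs_initProg (w : Fin n → Fin n → ℝ) :
    Runs (initProg k) (cliqueInput w) (11 * n ^ 2 + 8 * n + 12) fun s =>
      Ready w (penalty k w) s ∧ PointBuffer [] s := by
  let R (s : State) : Prop := ScratchEq 2 (cliqueInput w) s ∧ s.ireg 2 = 1 ∧ s.rreg 9 = 0
  have hconst : Runs (.block [.iconst 2 1, .rconst 9 0]) (cliqueInput w) 3 R :=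
    .block ⟨.foldl_apply (by simp [Instr.IsScratch]), by simp [Instr.apply], by simp [Instr.apply]⟩
  have hpenalty {s₁ s₂ : State} : R s₁ → (ScratchEq 3 s₁ s₂ ∧ s₂.rreg 9 = s₁.rreg 9 +
      weightBound w) → Runs (.block [.rconst 7 (2 * k ^ 2), .rmul 7 7 9, .rconst 8 1,
        .radd 2 7 8]) s₂ 5 fun s => Ready w (penalty k w) s ∧ PointBuffer [] s := by
    rintro ⟨h₁, hone₁, hzero₁⟩ ⟨h₂, hsum⟩
    have hgraph : s₂.rarr 0 = (cliqueInput w).rarr 0 := by rw [h₂.rarr, h₁.rarr]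
    have hbound : s₂.rreg 9 = weightBound w := by rw [hsum, hzero₁, zero_add]
    have hzero : s₂.rreg 0 = 0 := (h₂.rreg 0 (by lia)).trans (h₁.rreg 0 (by lia))
    have horder : s₂.ireg 0 = n := (h₂.ireg 0 (by lia)).trans (h₁.ireg 0 (by lia))
    have hone : s₂.ireg 2 = 1 := (h₂.ireg 2 (by lia)).trans hone₁
    refine .block ⟨?_, ?_⟩
    · constructor <;> simp [Instr.apply, hgraph, hbound, hzero, horder, hone, penalty]
    · exact ((h₁.trans ((h₂.mono (by lia)).trans (.foldl_apply
        (by simp [Instr.IsScratch])))).appends_nil (by lia)).buffer [] (pointBuffer_cliqueInput w)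
  refine (hconst.seq fun s₁ h₁ => (runs_weightBoundProg (n := n) (w := w)
    (h₁.1.ireg 0 (by lia)) h₁.2.1 (congrFun h₁.1.rarr 0)).seq fun s₂ h₂ =>
    hpenalty h₁ h₂).mono (by lia) fun _ => id

theorem runs_heavyProg (h : Ready w M s) (hs : PointBuffer (reductionPoints k w M) s) :
    Runs (heavyProg k) s 15 fun s' =>
      PointBuffer (reductionInstance k w M) s' ∧ s'.rreg 4 = reductionOffset k w M ∧
        s'.ireg 0 = n ∧ s'.ireg 2 = 1 := by
  have hconst : Runs (.block [.rcast 3 1, .rmul 3 3 2, .rconst 4 k, .rmul 4 4 2, .radd 4 3 4]) s 6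
      fun s₁ => ScratchEq 3 s s₁ ∧ s₁.rreg 3 = (reductionPoints k w M).length * M ∧
        s₁.rreg 4 = reductionOffset k w M :=
    .block ⟨.foldl_apply (by simp [Instr.IsScratch]), by
      simp [Instr.apply, h.reward, hs.length, reductionOffset]⟩
  refine hconst.seq (T₂ := 9) fun s₁ ⟨h₁, hheavy, hoffset⟩ => ?_
  have hnil := h₁.appends_nil (by lia)
  have hready := h.of_frame hnil.toFrame (by lia)
  refine (runs_emitProg (c := 40) (by lia) hready.one).mono le_rfl fun s₂ h₂ => ⟨?_, ?_, ?_, ?_⟩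
  · have hbuffer := h₂.buffer _ (hnil.buffer _ hs)
    rwa [List.append_nil, hheavy, hready.zero] at hbuffer
  · exact (h₂.rreg 4 (by lia)).trans hoffset
  · exact (h₂.ireg 0 (by lia) (by lia)).trans hready.order
  · exact (h₂.ireg 2 (by lia) (by lia)).trans hready.one

open Classical in
/-- The contribution of the `i`-th point in the real arrays `1`, `2`, `3` to the weight of the box
with corners in the real registers `40` to `43`. -/
noncomputable def boxTerm (s : State) (i : ℕ) : ℝ :=
  if (s.rarr 1 i, s.rarr 2 i) ∈ Set.Icc (s.rreg 40, s.rreg 41) (s.rreg 42, s.rreg 43) then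
    s.rarr 3 i
  else 0

theorem ScratchEq.boxTerm_eq {c : ℕ} {s s' : State} (h : ScratchEq c s s') (i : ℕ) :
    boxTerm s' i = boxTerm s i := by
  have hcorner (r : ℕ) : s'.rreg (r + 40) = s.rreg (r + 40) := congrArg (State.rreg · r) h.high
  rw [boxTerm, boxTerm, h.rarr, hcorner 0, hcorner 1, hcorner 2, hcorner 3]

theorem sum_boxTerm {l : List WeightedPoint} {s s' : State} (h : PointBuffer l s)
    (hs : AgreeBelow 40 s s') : ∑ i ∈ Finset.range l.length, boxTerm s' i =
      boxSum l (s'.rreg 40, s'.rreg 41) (s'.rreg 42, s'.rreg 43) := by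
  rw [← boxWeight_eq_boxSum, boxWeight, Finset.sum_filter, Finset.sum_range]
  refine Finset.sum_congr rfl fun i _ => ?_
  rw [boxTerm, hs.rarr 1 (by lia), hs.rarr 2 (by lia), hs.rarr 3 (by lia), h.fst i i.2,
    h.snd i i.2, h.weight i i.2]
  rfl

theorem runs_scanStep {i : ℕ} (hi : s.ireg 5 = i) : Runs scanStep s 9 fun s' =>
    ScratchEq 7 s s' ∧ s'.rreg 9 = s.rreg 9 + boxTerm s i := by
  have hload : Runs (.block [.rload 10 1 5, .rload 11 2 5, .rload 12 3 5]) s 4 fun s₁ =>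
      ScratchEq 10 s s₁ ∧ s₁.rreg 10 = s.rarr 1 i ∧ s₁.rreg 11 = s.rarr 2 i ∧
        s₁.rreg 12 = s.rarr 3 i :=
    .block ⟨.foldl_apply (by simp [Instr.IsScratch]), by simp [Instr.apply, hi]⟩
  refine hload.seq (T₂ := 5) fun s₁ ⟨h₁, hx, hy, hg⟩ => ?_
  have hterm : boxTerm s i = if (s₁.rreg 10, s₁.rreg 11) ∈
      Set.Icc (s₁.rreg 40, s₁.rreg 41) (s₁.rreg 42, s₁.rreg 43) then s₁.rreg 12 else 0 := by
    rw [← h₁.boxTerm_eq, boxTerm, hx, hy, hg, h₁.rarr]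
  have hskip (hout : (s₁.rreg 10, s₁.rreg 11) ∉
      Set.Icc (s₁.rreg 40, s₁.rreg 41) (s₁.rreg 42, s₁.rreg 43)) :
      ScratchEq 7 s s₁ ∧ s₁.rreg 9 = s.rreg 9 + boxTerm s i :=
    ⟨h₁.mono (by lia), by rw [hterm, if_neg hout, add_zero, h₁.rreg 9 (by lia)]⟩
  refine .guard (T := 4) (by lia) (fun h => hskip fun hmem => not_lt_of_ge hmem.1.1 h) fun hlox =>
    .guard (T := 3) (by lia) (fun h => hskip fun hmem => not_lt_of_ge hmem.1.2 h) fun hloy =>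
    .guard (T := 2) (by lia) (fun h => hskip fun hmem => not_lt_of_ge hmem.2.1 h) fun hhix =>
    .guard (T := 1) (by lia) (fun h => hskip fun hmem => not_lt_of_ge hmem.2.2 h) fun hhiy =>
    .instr ⟨(h₁.mono (by lia)).trans (.apply (by simp [Instr.IsScratch])), ?_⟩
  rw [hterm, if_pos ⟨⟨le_of_not_gt hlox, le_of_not_gt hloy⟩, le_of_not_gt hhix,
    le_of_not_gt hhiy⟩]
  simp [Instr.apply, h₁.rreg]

theorem runs_scanProg {m : ℕ} (hm : s.ireg 1 = m) (hn : s.ireg 0 = n) (hone : s.ireg 2 = 1) :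
    Runs scanProg s (13 * m + 7) fun s' =>
      s'.rreg 0 = ∑ i ∈ Finset.range m, boxTerm s i - s.rreg 4 := by
  have hzero : Runs (.block [.rconst 9 0]) s 2 fun s₁ => ScratchEq 5 s s₁ ∧ s₁.rreg 9 = 0 :=
    .block ⟨.foldl_apply (by simp [Instr.IsScratch]), by simp [Instr.apply]⟩
  refine (hzero.seq fun s₁ ⟨h₁, hzero₁⟩ =>
    (Runs.sumRange (T := 9) (n := n) (f := boxTerm s) (z := 9)
    (by lia) (by lia) (by lia) ((h₁.ireg 1 (by lia)).trans hm) ((h₁.ireg 0 (by lia)).trans hn)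
    ((h₁.ireg 2 (by lia)).trans hone) fun i _ s₂ h₂ hi' _ => ?_).seq (T₂ := 1)
    fun s₂ ⟨h₂, hsum⟩ => .instr ?_).mono (by lia) fun _ => id
  · rw [← (h₁.trans h₂).boxTerm_eq i]
    exact runs_scanStep hi'
  · have hoffset : s₂.rreg 4 = s.rreg 4 := (h₂.rreg 4 (by lia)).trans (h₁.rreg 4 (by lia))
    simp [Instr.apply, hsum, hzero₁, hoffset]

end RealRAM

open RealRAM

theorem SolvesMaxWeightRectangle.runs_shift {P : Prog} {T : ℕ → ℕ}
    (hP : SolvesMaxWeightRectangle P T) {l : List WeightedPoint} {s : State}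
    (hs : PointBuffer l s) :
    Runs (P.shift 40) s (T l.length) fun s' => AgreeBelow 40 s s' ∧
      IsMaxWeightBox (fun i : Fin l.length => l[i].1) (fun i => l[i].2)
        (s'.rreg 40, s'.rreg 41) (s'.rreg 42, s'.rreg 43) := by
  obtain ⟨t, σ, hexec, ht, hmax⟩ := hP l.length (fun i => l[i].1) (fun i => l[i].2)
  obtain ⟨s', hexec', rfl, hagree⟩ := hexec.shift hs.high
  exact ⟨t, s', hexec', ht, hagree, hmax⟩

/-- The running time of `cliqueProg k P` if `T` is that of `P`. -/
def cliqueTime (k : ℕ) (T : ℕ → ℕ) (n : ℕ) : ℕ :=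
  ((k ^ 2 + k) * (13 * k + 98) + 31) * n ^ (k / 2 + 1) + 38 * T (numPoints k n + 1)

theorem SolvesMaxWeightRectangle.le_cliqueTime {P : Prog} {T : ℕ → ℕ}
    (hP : SolvesMaxWeightRectangle P T) (hk : 2 ≤ k) (hn : 0 < n) :
    11 * n ^ 2 + 8 * n + 12 + ((k ^ 2 + k) * (13 * k + 98) * n ^ (k / 2 + 1) + 2 + (15 +
      (T (numPoints k n + 1) + (13 * (numPoints k n + 1) + 7)))) ≤ cliqueTime k T n := by
  have hsq : n ^ 2 ≤ n ^ (k / 2 + 1) := Nat.pow_le_pow_right hn (by lia)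
  have hself : n ≤ n ^ 2 := Nat.le_self_pow two_ne_zero n
  have hread := hP.le_time (numPoints k n + 1)
  rw [cliqueTime, add_mul]
  lia

theorem solvesMaxWeightClique_cliqueProg {P : Prog} {T : ℕ → ℕ}
    (hP : SolvesMaxWeightRectangle P T) (hk : 2 ≤ k) :
    SolvesMaxWeightClique k (cliqueProg k P) (cliqueTime k T) := by
  intro n w hkn hw
  have hn : 0 < n := by lia
  have hlen := length_reductionInstance (k := k) w (penalty k w)
  refine ((runs_initProg w).seq fun s₁ ⟨hready, hempty⟩ =>
    (runs_reductionProg hready hn).seq fun s₂ h₂ =>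
    (runs_heavyProg (hready.of_frame h₂.toFrame (by lia)) (h₂.buffer [] hempty)).seq
    fun s₃ ⟨hbuffer, hoffset, horder, hone⟩ =>
    (hP.runs_shift hbuffer).seq fun s₄ ⟨h₄, hmax⟩ =>
    (runs_scanProg (n := n) ((h₄.ireg 1 (by lia)).trans hbuffer.length)
      ((h₄.ireg 0 (by lia)).trans horder) ((h₄.ireg 2 (by lia)).trans hone)).mono le_rfl
    fun s₅ hs₅ => ?_).mono (Q := fun s => IsGreatest _ (s.rreg 0)) ?_ fun _ => id
  · rw [hlen]
    exact hP.le_cliqueTime hk hn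
  · rw [hs₅, sum_boxTerm hbuffer h₄, h₄.rreg 4 (by lia), hoffset]
    exact isGreatest_of_isMaxWeightBox (by lia) hkn hw rfl hmax

section Growth

theorem isLittleO_natCast_rpow_rpow {a b : ℝ} (h : a < b) :
    (fun n : ℕ => (n : ℝ) ^ a) =o[atTop] fun n : ℕ => (n : ℝ) ^ b := by
  refine (isLittleO_iff_tendsto' ?_).2 (((tendsto_rpow_neg_atTop (sub_pos.2 h)).comp
    tendsto_natCast_atTop_atTop).congr' ?_)
  · filter_upwards [eventually_gt_atTop 0] with n hn hzero
    exact absurd hzero (Real.rpow_pos_of_pos (Nat.cast_pos.2 hn) b).ne'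
  · filter_upwards [eventually_gt_atTop 0] with n hn
    rw [Function.comp_apply, neg_sub, Real.rpow_sub (Nat.cast_pos.2 hn)]

theorem isBigO_natCast_rpow_rpow {a b : ℝ} (h : a ≤ b) :
    (fun n : ℕ => (n : ℝ) ^ a) =O[atTop] fun n : ℕ => (n : ℝ) ^ b := by
  rcases h.eq_or_lt with rfl | h
  · exact isBigO_refl _ _
  · exact (isLittleO_natCast_rpow_rpow h).isBigO

theorem isBigO_natCast_rpow_comp {α : Type*} {l : Filter α} {T : ℕ → ℕ} {a : ℝ}
    (hT : (fun N : ℕ => (T N : ℝ)) =O[atTop] fun N : ℕ => (N : ℝ) ^ a) {g : α → ℕ}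
    (hg : ∀ x, 0 < g x) : (fun x => (T (g x) : ℝ)) =O[l] fun x => (g x : ℝ) ^ a := by
  obtain ⟨C, -, hC⟩ := bound_of_isBigO_nat_atTop hT
  exact .of_bound C (.of_forall fun x =>
    hC (Real.rpow_pos_of_pos (Nat.cast_pos.2 (hg x)) a).ne')

theorem SolvesMaxWeightRectangle.le_one {P : Prog} {T : ℕ → ℕ}
    (hP : SolvesMaxWeightRectangle P T) {ε : ℝ}
    (hT : (fun N : ℕ => (T N : ℝ)) =O[atTop] fun N : ℕ => (N : ℝ) ^ (2 - ε)) : ε ≤ 1 := by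
  by_contra! hε
  have hread : (fun N : ℕ => (N : ℝ) ^ (1 : ℝ)) =O[atTop] fun N : ℕ => (T N : ℝ) :=
    .of_bound 1 (.of_forall fun N => by simpa using hP.le_time N)
  refine (hread.trans hT).not_isLittleO (Eventually.frequently ?_)
    (isLittleO_natCast_rpow_rpow (by linarith))
  filter_upwards [eventually_gt_atTop 0] with N hN
  exact (Real.rpow_pos_of_pos (Nat.cast_pos.2 hN) 1).ne'

variable {k : ℕ} {ε : ℝ}

theorem half_add_one_mul_two_sub_le (hε : ε ≤ 1) (hk : 4 ≤ k * ε) :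
    ((k / 2 + 1 : ℕ) : ℝ) * (2 - ε) ≤ k - ε := by
  have hhalf : ((k / 2 : ℕ) : ℝ) ≤ k / 2 := Nat.cast_div_le
  push_cast
  nlinarith

theorem isBigO_numPoints_add_one (k : ℕ) :
    (fun n : ℕ => ((numPoints k n + 1 : ℕ) : ℝ)) =O[atTop]
      fun n : ℕ => (n : ℝ) ^ ((k / 2 + 1 : ℕ) : ℝ) := by
  refine .of_bound (4 * (k ^ 2 + k) + 1 : ℕ) ?_
  filter_upwards [eventually_gt_atTop 0] with n hn
  have hone := Nat.one_le_pow (k / 2 + 1) n hn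
  have hle : numPoints k n + 1 ≤ (4 * (k ^ 2 + k) + 1) * n ^ (k / 2 + 1) := by
    linarith [numPoints_le (k := k) hn]
  rw [Real.rpow_natCast, norm_pow, Real.norm_natCast, Real.norm_natCast]
  exact_mod_cast hle

theorem isBigO_cliqueTime {T : ℕ → ℕ} (hε : ε ≤ 1) (hk : 4 ≤ k * ε)
    (hT : (fun N : ℕ => (T N : ℝ)) =O[atTop] fun N : ℕ => (N : ℝ) ^ (2 - ε)) :
    (fun n : ℕ => (cliqueTime k T n : ℝ)) =O[atTop] fun n : ℕ => (n : ℝ) ^ ((k : ℝ) - ε) := by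
  have hexp := half_add_one_mul_two_sub_le hε hk
  have hbuild : (fun n : ℕ => (n : ℝ) ^ ((k / 2 + 1 : ℕ) : ℝ)) =O[atTop]
      fun n : ℕ => (n : ℝ) ^ ((k : ℝ) - ε) :=
    isBigO_natCast_rpow_rpow (le_trans (le_mul_of_one_le_right (by positivity) (by linarith)) hexp)
  have hsolve : (fun n : ℕ => (T (numPoints k n + 1) : ℝ)) =O[atTop]
      fun n : ℕ => (n : ℝ) ^ ((k : ℝ) - ε) :=
    calc (fun n : ℕ => (T (numPoints k n + 1) : ℝ))
      _ =O[atTop] fun n : ℕ => ((numPoints k n + 1 : ℕ) : ℝ) ^ (2 - ε) :=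
        isBigO_natCast_rpow_comp hT fun n => Nat.succ_pos _
      _ =O[atTop] fun n : ℕ => ((n : ℝ) ^ ((k / 2 + 1 : ℕ) : ℝ)) ^ (2 - ε) :=
        (isBigO_numPoints_add_one k).rpow (by linarith) (.of_forall fun n => by positivity)
      _ =O[atTop] fun n : ℕ => (n : ℝ) ^ (((k / 2 + 1 : ℕ) : ℝ) * (2 - ε)) :=
        (isBigO_refl _ _).congr_right fun n => (Real.rpow_mul n.cast_nonneg _ _).symm
      _ =O[atTop] fun n : ℕ => (n : ℝ) ^ ((k : ℝ) - ε) := isBigO_natCast_rpow_rpow hexp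
  refine ((hbuild.const_mul_left ((k ^ 2 + k) * (13 * k + 98) + 31)).add
    (hsolve.const_mul_left 38)).congr_left fun n => ?_
  rw [cliqueTime, Real.rpow_natCast]
  push_cast
  rfl

end Growth

theorem mainTheorem2_general (ε : ℝ) (k : ℕ) (hk : 4 ≤ k * ε)
    (hrect : ∃ (P : RealRAM.Prog) (T : ℕ → ℕ), SolvesMaxWeightRectangle P T ∧
      (fun N : ℕ => (T N : ℝ)) =O[atTop] (fun N : ℕ => (N : ℝ) ^ (2 - ε))) :
    ∃ (Q : RealRAM.Prog) (T : ℕ → ℕ), SolvesMaxWeightClique k Q T ∧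
      (fun n : ℕ => (T n : ℝ)) =O[atTop] (fun n : ℕ => (n : ℝ) ^ ((k : ℝ) - ε)) := by
  obtain ⟨P, T, hP, hT⟩ := hrect
  have hε : ε ≤ 1 := hP.le_one hT
  have hk₂ : (2 : ℝ) ≤ k := by nlinarith [k.cast_nonneg (α := ℝ)]
  exact ⟨cliqueProg k P, cliqueTime k T,
    solvesMaxWeightClique_cliqueProg hP (by exact_mod_cast hk₂), isBigO_cliqueTime hε hk hT⟩

theorem mainTheorem2 (ε : ℝ) (hε : 0 < ε)
    (hrect : ∃ (P : RealRAM.Prog) (T : ℕ → ℕ), SolvesMaxWeightRectangle P T ∧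
      (fun N : ℕ => (T N : ℝ)) =O[atTop] (fun N : ℕ => (N : ℝ) ^ (2 - ε))) :
    ∃ (Q : RealRAM.Prog) (T : ℕ → ℕ), SolvesMaxWeightClique ⌈4 / ε⌉₊ Q T ∧
      (fun n : ℕ => (T n : ℝ)) =O[atTop] (fun n : ℕ => (n : ℝ) ^ ((⌈4 / ε⌉₊ : ℝ) - ε)) :=
  mainTheorem2_general ε _ ((div_le_iff₀ hε).1 (Nat.le_ceil _)) hrect
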